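/- **Model.** $n\ge 1$ nodes have distinct identities in $[N]=\{1,\dots,N\}$ and are fully connected. Each node knows $n$, $N$ and its own identity; it sees its links only as arbitrarily numbered ports, and knows no other identity in advance. Computation proceeds in synchronous rounds, started simultaneously; in each round a node may send one message over each link, which is delivered by the end of the round, and local computation is free. Identities, port numberings and a set of $f$ Byzantine nodes, unknown to the correct nodes, are fixed by an adversary before the execution. Then a shared random string, accessible to all nodes, and an independent private random string for each node are drawn. Byzantine nodes behave arbitrarily; their behaviour may depend on all random strings and on all messages sent so far, including those of the current round. Messages are authenticated: the receiver of a message learns the true identity of its sender, and nodes can sign terms with unforgeable, transferable signatures, so that a term signed under an identity of a correct node can be sent by other nodes only after that node has sent it. (A signature counts as $O(\log N)$ bits.) **Theorem.** For all constants $\delta>0$ and $\beta\ge 1$ there are a randomized algorithm and a constant $K$ such that the following holds for all $N\ge n\ge 1$, all identities in $[N]$, all port numberings and all sets of $f$ Byzantine nodes with $0\le f<(1/3-\delta)n$. Every message that a correct node sends has $O(\log N)$ bits (at most $K(\lfloor\log_2 N\rfloor+1)$). Against every behaviour of the Byzantine nodes, with probability at least $1-1/n^{\beta}$: 1. every correct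 node halts within $K\log^6 n=\tilde O(1)$ rounds; 2. the correct nodes output pairwise distinct new identities in $\{1,\dots,n\}$ (strong renaming), and if two correct nodes have original identities $\mathrm{id}(u)<\mathrm{id}(v)$, then the new identity of $u$ is smaller than that of $v$ (order preservation); 3. the correct nodes send at most $Kn\log^3 n=\tilde O(n)$ messages in total. -/

import Mathlib

namespace ByzRenaming

/-- Messages: numbers, pairs, and terms signed under an identity (signatures are unforgeable and
transferable; see `Protocol.authentic` and `Authentic` below). -/
inductive Msg : Type
  | num (k : ℕ) : Msg
  | pair (a b : Msg) : Msg
  | signed (i : ℕ) (m : Msg) : Msg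

/-- Length of a message in bits. A signature takes the signer's identity and a tag
of the length of an identity in `[N]`. -/
def Msg.bits (N : ℕ) : Msg → ℕ
  | .num k => Nat.size k + 1
  | .pair a b => a.bits N + b.bits N + 1
  | .signed i m => Nat.size i + Nat.size N + m.bits N + 1

/-- All signed terms `(signer, content)` that occur in a message, at any depth. -/
def Msg.signatures : Msg → Set (ℕ × Msg)
  | .num _ => ∅
  | .pair a b => a.signatures ∪ b.signatures
  | .signed i m => insert (i, m) m.signatures

/-- What a node receives in one round: on each of its `n` ports at most one message, together with
the (authenticated) identity of its sender. -/
abbrev Inbox (n : ℕ) : Type := Fin n → Option (ℕ × Msg)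

/-- A randomized protocol for `n` nodes. A node acts on the shared random string, its own private
random string, its own identity, and the list of the inboxes of all rounds so far (oldest first):
`send` gives the message, if any, that it sends on each port in the next round, and `output` its
new identity once it decides. Local computation is free. A node signs only under its own identity;
signed terms of other nodes can only be passed on after they have been received. -/
structure Protocol (n : ℕ) where
  Shared : Type
  Private : Type
  finite_shared : Finite Shared
  finite_private : Finite Private
  nonempty_shared : Nonempty Shared
  nonempty_private : Nonempty Private
  send : Shared → Private → ℕ → List (Inbox n) → Fin n → Option Msg
  output : Shared → Private → ℕ → List (Inbox n) → Option ℕ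
  authentic : ∀ s p i h q m, send s p i h q = some m → ∀ σ ∈ m.signatures,
    σ.1 = i ∨ ∃ box ∈ h, ∃ q' j m', box q' = some (j, m') ∧ σ ∈ m'.signatures

/-- The outcomes of all random choices: one shared string, and one private string per node. -/
abbrev Protocol.Coins {n : ℕ} (P : Protocol n) : Type := P.Shared × (Fin n → P.Private)

/-- Probability of an event when the shared string and all the private strings are uniform and
independent. -/
noncomputable def Protocol.prob {n : ℕ} (P : Protocol n) (E : Set P.Coins) : ℝ :=
  (E.ncard : ℝ) / (Nat.card P.Coins : ℝ)

/-- No node ever sends a message of more than `B` bits. -/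
def Protocol.MessagesAtMost {n : ℕ} (P : Protocol n) (N B : ℕ) : Prop :=
  ∀ s p, ∀ i ∈ Set.Icc 1 N, ∀ h q m, P.send s p i h q = some m → m.bits N ≤ B

/-- The decision of a node with the given inboxes: the first output that it has produced. -/
def Protocol.decision {n : ℕ} (P : Protocol n) (s : P.Shared) (p : P.Private) (i : ℕ)
    (h : List (Inbox n)) : Option ℕ :=
  h.inits.findSome? (P.output s p i)

/-- What a correct node puts on a port: it follows the protocol until it has decided, and then
halts and is silent. -/
def Protocol.emit {n : ℕ} (P : Protocol n) (s : P.Shared) (p : P.Private) (i : ℕ)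
    (h : List (Inbox n)) (q : Fin n) : Option Msg :=
  if (P.decision s p i h).isSome then none else P.send s p i h q

/-- What is fixed before the execution: distinct identities in `[N]` of the `n` nodes, the set of
Byzantine nodes, and at each node `v` a numbering of its links: port `q` of `v` leads to the node
`port v q` (one of the ports leads to `v` itself). Nodes see port numbers only. -/
structure Network (n N : ℕ) where
  ident : Fin n → ℕ
  ident_injective : Function.Injective ident
  ident_mem : ∀ v, ident v ∈ Set.Icc 1 N
  byz : Finset (Fin n)
  port : Fin n → Equiv.Perm (Fin n)

/-- `b r u v` is the message, if any, that the Byzantine node `u` sends to `v` in round `r`. -/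
abbrev Behaviour (n : ℕ) : Type := ℕ → Fin n → Fin n → Option Msg

section Execution

variable {n N : ℕ} (P : Protocol n) (G : Network n N) (ω : P.Coins) (b : Behaviour n)

/-- The message from `u` to `v` in round `r`, if `h` lists the inboxes of all nodes before it. -/
def transmit (h : Fin n → List (Inbox n)) (r : ℕ) (u v : Fin n) : Option Msg :=
  if u ∈ G.byz then b r u v
  else P.emit ω.1 (ω.2 u) (G.ident u) (h u) ((G.port u).symm v)

/-- The inboxes of each node in rounds `0, …, r - 1`. -/
def history : ℕ → Fin n → List (Inbox n)
  | 0 => fun _ => []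
  | r + 1 => fun v => history r v ++
      [fun q => (transmit P G ω b (history r) r (G.port v q) v).map
        (Prod.mk (G.ident (G.port v q)))]

/-- The message from `u` to `v` in round `r`. -/
def sent (r : ℕ) (u v : Fin n) : Option Msg :=
  transmit P G ω b (history P G ω b r) r u v

/-- The decision of the correct node `v` after `t` rounds. -/
def decided (t : ℕ) (v : Fin n) : Option ℕ :=
  P.decision ω.1 (ω.2 v) (G.ident v) (history P G ω b t v)

/-- Number of messages sent by correct nodes in the first `t` rounds. -/
def messageCount (t : ℕ) : ℕ :=
  ∑ r ∈ Finset.range t, ∑ u ∈ G.byzᶜ,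
    (Finset.univ.filter fun v => (sent P G ω b r u v).isSome = true).card

/-- Message authentication: the Byzantine nodes (who may share their keys, and see all messages of
correct nodes up to and including the current round) can use a signature under an identity that is
not one of theirs only if a correct node has sent it. -/
def Authentic : Prop :=
  ∀ r, ∀ u ∈ G.byz, ∀ v m, b r u v = some m → ∀ σ ∈ m.signatures,
    (∃ w ∈ G.byz, σ.1 = G.ident w) ∨
      ∃ r' ≤ r, ∃ u' ∉ G.byz, ∃ v' m', sent P G ω b r' u' v' = some m' ∧ σ ∈ m'.signatures

/-- `new` is a strong and order-preserving renaming of the correct nodes. -/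
def IsStrongOrderPreserving (new : Fin n → ℕ) : Prop :=
  (∀ v ∉ G.byz, new v ∈ Set.Icc 1 n) ∧
  (∀ u ∉ G.byz, ∀ v ∉ G.byz, new u = new v → u = v) ∧
  (∀ u ∉ G.byz, ∀ v ∉ G.byz, G.ident u < G.ident v → new u < new v)

/-- Within `T` rounds all correct nodes have halted with a strong and order-preserving renaming,
and they have sent at most `M` messages altogether. -/
def Succeeds (T M : ℝ) : Prop :=
  ∃ t : ℕ, (t : ℝ) ≤ T ∧
    (∃ new : Fin n → ℕ, (∀ v ∉ G.byz, decided P G ω b t v = some (new v)) ∧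
      IsStrongOrderPreserving G new) ∧
    (messageCount P G ω b t : ℝ) ≤ M

end Execution

end ByzRenaming

/-!
The protocol runs a Byzantine agreement on the set of participants, in which the work is spread
over all nodes. The shared random string is drawn after the Byzantine nodes have been fixed, and
distributes the possible identities over `Θ(n / log n)` buckets. By a Chernoff bound
(`card_deviation_le`, `card_not_balanced_le`), in every bucket the Byzantine nodes number at most
`b` and the correct ones more than `2 * b`, and its size is `O(log n)`. The nodes of bucket `0` are
the hubs. They greet all nodes, every node reports to all hubs, and so the hubs can reach all nodes
and are reachable from them.

Correct hubs hold different sets of participants at first, because a Byzantine node may report to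
some hubs only. For every identity `v` they run a consensus on whether `v` takes part, with a
variant of the phase king algorithm in which the hubs never talk to one another, but only to the
members of the bucket of `v`. This bounds the load of each link by the size of a bucket, so that a
step of all these instances takes `O(log n)` rounds with one identity per message. In a phase, the
hubs tell the members that they hold `v`; a member that has heard this from more than `b` hubs, or
from more than `2 * b`, reports that; a hub continues to hold `v` if more than `2 * b` members
report more than `2 * b` votes, or if more than `b` members report more than `b` votes and the king,
whose opinion is relayed by the members, is in favour. Silence counts as a vote against, hence
invented identities cause no traffic among correct nodes. Unanimity of the correct hubs persists
(`Plan.holds_succ_of_forall`, `Plan.not_holds_succ_of_forall`), and a phase whose only king is a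
correct hub brings it about (`Plan.holds_succ_of_king`). Kings are chosen by the shared random
string, and each phase has a unique correct king with constant probability
(`card_no_unique_zero_le`), independently of the others; `O(log n)` phases suffice.

In the end all correct hubs hold the same set, which contains the identities of all correct nodes,
and only identities of nodes. They tell each node its rank in this set, and a node adopts the rank
announced by more than `b` hubs (`Plan.exists_newName`). This takes `O(log ^ 2 n)` rounds. In every
round only messages from or to hubs are sent, `O(n log n)` in number (`Plan.messageCount_le`).

Given the plan, the argument is deterministic, and it relies on the authentication of senders only.
So the Byzantine behaviour may depend on all random choices.
-/

/-! ### The protocol -/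

namespace ByzRenaming

/-- What the shared random string determines: a distribution of all possible identities over
`m + 1` buckets, bucket `0` being the committee of hubs, and for each phase the identities that may
act as king in it; further the number of phases, the number of rounds (`slots`) in which one set of
topics is sent over a link, and a bound on the number of Byzantine nodes in a bucket. -/
structure Plan (m : ℕ) where
  bucket : ℕ → Fin (m + 1)
  king : ℕ → ℕ → Prop
  phases : ℕ
  slots : ℕ
  bound : ℕ

/-- The inboxes of a node in all rounds. -/
abbrev View (n : ℕ) : Type := ℕ → Inbox n

/-- The view that consists of the inboxes listed in `h`, and of empty ones from then on. -/
def viewOf {n : ℕ} (h : List (Inbox n)) : View n := fun r => h.getD r fun _ => none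

open scoped Classical

namespace Plan

variable {n m : ℕ} (p : Plan m) (N : ℕ) (V V' : View n)

/-- The topic `v` has been received on port `q` in one of the slots of block `τ`. Blocks of `slots`
rounds start at round `2`; phase `j` consists of the blocks `5 * j, …, 5 * j + 4`. -/
def Heard (τ : ℕ) (q : Fin n) (v : ℕ) : Prop :=
  ∃ s < p.slots, ∃ i, V (2 + τ * p.slots + s) q = some (i, .num v)

/-- Port `q` leads to a hub, as the greeting of round `0` has revealed. -/
def HubPort (q : Fin n) : Prop := ∃ x, V 0 q = some x ∧ p.bucket x.1 = 0

/-- Port `q` leads to a node of bucket `B` that has reported to the hubs in round `1`. -/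
def PeerIn (q : Fin n) (B : Fin (m + 1)) : Prop := ∃ x, V 1 q = some x ∧ p.bucket x.1 = B

/-- Number of hubs that have told this node in phase `j` that they hold `v`. -/
noncomputable def votes (j v : ℕ) : ℕ :=
  (Finset.univ.filter fun q => p.HubPort V q ∧ p.Heard V (5 * j) q v).card

/-- Number of members of the bucket of `v` that have reported to this hub in block `τ` on `v`. -/
noncomputable def reports (τ v : ℕ) : ℕ :=
  (Finset.univ.filter fun q => p.PeerIn V q (p.bucket v) ∧ p.Heard V τ q v).card

/-- The hub takes `v` for a participant when phase `j` begins: initially if `v` has reported to it;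
later if more than `2 * bound` members of the bucket of `v` have seen more than `2 * bound` votes
for `v`, or if more than `bound` of them have seen more than `bound` votes and the king is for
`v`. -/
def Holds : ℕ → ℕ → Prop
  | 0, v => ∃ q x, V 1 q = some x ∧ x.1 = v
  | j + 1, v => 2 * p.bound < p.reports V (5 * j + 2) v ∨
      (p.bound < p.reports V (5 * j + 1) v ∧ p.bound < p.reports V (5 * j + 4) v)

/-- The node with identity `i` puts `v` on port `q` in the given block (of five) of phase `j`.
Hubs talk to the members of the bucket of `v` in blocks `0` and `3`, the members to the hubs in
blocks `1`, `2` and `4`. Saying nothing about `v` is a vote against `v`. -/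
def Says (i j : ℕ) (q : Fin n) (v : ℕ) : ℕ → Prop
  | 0 => p.bucket i = 0 ∧ p.PeerIn V q (p.bucket v) ∧ p.Holds V j v
  | 1 => p.HubPort V q ∧ p.bucket i = p.bucket v ∧ p.bound < p.votes V j v
  | 2 => p.HubPort V q ∧ p.bucket i = p.bucket v ∧ 2 * p.bound < p.votes V j v
  | 3 => p.bucket i = 0 ∧ p.king j i ∧ p.PeerIn V q (p.bucket v) ∧
      p.bound < p.reports V (5 * j + 2) v
  | _ => p.HubPort V q ∧ p.bucket i = p.bucket v ∧ ∃ q' x, V 0 q' = some x ∧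
      p.bucket x.1 = 0 ∧ p.king j x.1 ∧ p.Heard V (5 * j + 3) q' v

/-- The topics that the node with identity `i` has to send on port `q` in block `τ`. -/
noncomputable def topics (i τ : ℕ) (q : Fin n) : Finset ℕ :=
  (Finset.Icc 1 N).filter fun v => p.Says V i (τ / 5) q v (τ % 5)

/-- The new identity that a hub computes for the identity `w` after the last phase. -/
noncomputable def rank (w : ℕ) : ℕ :=
  ((Finset.Icc 1 N).filter fun v => v ≤ w ∧ p.Holds V p.phases v).card

/-- The round after the last phase, in which the hubs announce the new identities. -/
def lastRound : ℕ := 2 + 5 * p.phases * p.slots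

/-- What the node with identity `i` sends on port `q` in round `r`. -/
noncomputable def message (i r : ℕ) (q : Fin n) : Option Msg :=
  if r = 0 then if p.bucket i = 0 then some (.num 0) else none
  else if r = 1 then if p.HubPort V q then some (.num 0) else none
  else if r < p.lastRound then
    ((p.topics N V i ((r - 2) / p.slots) q).toList[(r - 2) % p.slots]?).map .num
  else if p.bucket i = 0 then (V 1 q).map fun x => .num (p.rank N V x.1)
  else none

/-- Number of hubs that have announced `k` to this node as its new identity. -/
noncomputable def announcements (k : ℕ) : ℕ :=
  (Finset.univ.filter fun q => p.HubPort V q ∧ ∃ i, V p.lastRound q = some (i, .num k)).card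

/-- The new identity of a node: a number announced by more hubs than there are Byzantine ones. In
the executions considered there is exactly one such number, so that `sInf` only selects it. -/
noncomputable def newName : ℕ := sInf {k | p.bound < p.announcements V k}

variable {p N V V'}

lemma heard_congr {τ : ℕ} (h : ∀ r < 2 + (τ + 1) * p.slots, V r = V' r) (q : Fin n) (v : ℕ) :
    p.Heard V τ q v ↔ p.Heard V' τ q v := by
  have : ∀ s < p.slots, V (2 + τ * p.slots + s) = V' (2 + τ * p.slots + s) := fun s hs =>
    h _ (by rw [add_mul]; omega)
  constructor
  · rintro ⟨s, hs, i, hi⟩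
    exact ⟨s, hs, i, by rw [← this s hs]; exact hi⟩
  · rintro ⟨s, hs, i, hi⟩
    exact ⟨s, hs, i, by rw [this s hs]; exact hi⟩

lemma hubPort_congr (h : V 0 = V' 0) (q : Fin n) : p.HubPort V q ↔ p.HubPort V' q := by
  simp only [HubPort, h]

lemma peerIn_congr (h : V 1 = V' 1) (q : Fin n) (B : Fin (m + 1)) :
    p.PeerIn V q B ↔ p.PeerIn V' q B := by
  simp only [PeerIn, h]

lemma votes_congr {j : ℕ} (h : ∀ r < 2 + (5 * j + 1) * p.slots, V r = V' r) (v : ℕ) :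
    p.votes V j v = p.votes V' j v := by
  simp only [votes, hubPort_congr (p := p) (h 0 (by omega)), heard_congr h]

lemma reports_congr {τ : ℕ} (h : ∀ r < 2 + (τ + 1) * p.slots, V r = V' r) (v : ℕ) :
    p.reports V τ v = p.reports V' τ v := by
  simp only [reports, peerIn_congr (p := p) (h 1 (by omega)), heard_congr h]

lemma holds_congr {j : ℕ} (h : ∀ r < 2 + 5 * j * p.slots, V r = V' r) (v : ℕ) :
    p.Holds V j v ↔ p.Holds V' j v := by
  cases j with
  | zero => simp only [Holds, h 1 (by omega)]
  | succ j =>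
    have hm : ∀ τ, τ < 5 * j + 5 → p.reports V τ v = p.reports V' τ v := fun τ hτ =>
      reports_congr (fun r hr => h r (hr.trans_le (by
        have := Nat.mul_le_mul_right p.slots (show τ + 1 ≤ 5 * (j + 1) by omega)
        omega))) v
    simp only [Holds, hm (5 * j + 1) (by omega), hm (5 * j + 2) (by omega),
      hm (5 * j + 4) (by omega)]

lemma says_congr {j a : ℕ} (ha : a < 5) (h : ∀ r < 2 + (5 * j + a) * p.slots, V r = V' r)
    (i : ℕ) (q : Fin n) (v : ℕ) : p.Says V i j q v a ↔ p.Says V' i j q v a := by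
  have h0 : V 0 = V' 0 := h 0 (by omega)
  have h1 : V 1 = V' 1 := h 1 (by omega)
  have hm : ∀ τ, τ < 5 * j + a → ∀ r < 2 + (τ + 1) * p.slots, V r = V' r := fun τ hτ r hr =>
    h r (hr.trans_le (by
      have := Nat.mul_le_mul_right p.slots (show τ + 1 ≤ 5 * j + a by omega)
      omega))
  interval_cases a
  · simp only [Says, peerIn_congr (p := p) h1, holds_congr (p := p) h]
  · simp only [Says, hubPort_congr (p := p) h0, votes_congr (hm (5 * j) (by omega))]
  · simp only [Says, hubPort_congr (p := p) h0, votes_congr (hm (5 * j) (by omega))]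
  · simp only [Says, peerIn_congr (p := p) h1, reports_congr (hm (5 * j + 2) (by omega))]
  · simp only [Says, hubPort_congr (p := p) h0, h0, heard_congr (hm (5 * j + 3) (by omega))]

/-- Messages depend only on what has been received in earlier rounds. -/
lemma message_congr {r : ℕ} (h : ∀ r' < r, V r' = V' r') (i : ℕ) (q : Fin n) :
    p.message N V i r q = p.message N V' i r q := by
  unfold message
  by_cases h0 : r = 0
  · simp only [h0, if_true]
  by_cases h1 : r = 1
  · simp only [h1, if_true, hubPort_congr (p := p) (h 0 (by omega))]
  by_cases hl : r < p.lastRound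
  · have : p.topics N V i ((r - 2) / p.slots) q = p.topics N V' i ((r - 2) / p.slots) q := by
      refine Finset.filter_congr fun v _ => says_congr (Nat.mod_lt _ (by omega)) ?_ i q v
      intro r' hr'
      refine h r' (hr'.trans_le ?_)
      rw [Nat.div_add_mod]
      have := Nat.div_mul_le_self (r - 2) p.slots
      omega
    simp only [h0, h1, hl, if_true, if_false, this]
  · have : ∀ w, p.rank N V w = p.rank N V' w := fun w => by
      unfold rank
      congr 1
      refine Finset.filter_congr fun v _ => ?_
      rw [holds_congr fun r' hr' => h r' (hr'.trans_le (by unfold lastRound at hl; omega))]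
    simp only [h0, h1, hl, if_false, h 1 (by omega), this]

lemma message_eq_num {i r : ℕ} {q : Fin n} {x : Msg} (h : p.message N V i r q = some x) :
    ∃ k ≤ N, x = .num k := by
  unfold message at h
  split_ifs at h with h0 _ h1 h2 hl hb
  · exact ⟨0, by omega, by simpa using h.symm⟩
  · exact ⟨0, by omega, by simpa using h.symm⟩
  · obtain ⟨k, hk, rfl⟩ := Option.map_eq_some_iff.1 h
    have := List.mem_of_getElem? hk
    rw [Finset.mem_toList, topics, Finset.mem_filter, Finset.mem_Icc] at this
    exact ⟨k, this.1.2, rfl⟩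
  · obtain ⟨x, _, rfl⟩ := Option.map_eq_some_iff.1 h
    exact ⟨_, (Finset.card_filter_le _ _).trans (by simp), rfl⟩

end Plan

/-- The renaming protocol, for a shared random string `s : S` that determines the plan `plan s`.
Private randomness and signatures are not used. -/
noncomputable def Plan.protocol {m : ℕ} {S : Type} [Finite S] [Nonempty S] (plan : S → Plan m)
    (n N : ℕ) : Protocol n where
  Shared := S
  Private := Unit
  finite_shared := inferInstance
  finite_private := inferInstance
  nonempty_shared := inferInstance
  nonempty_private := inferInstance
  send s _ i h q := (plan s).message N (viewOf h) i h.length q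
  output s _ _ h := if h.length = (plan s).lastRound + 1 then some ((plan s).newName (viewOf h))
    else none
  authentic s _ i h q x hx σ hσ := by
    obtain ⟨k, _, rfl⟩ := Plan.message_eq_num hx
    exact absurd hσ (Set.notMem_empty σ)

lemma Plan.protocol_messagesAtMost {m : ℕ} {S : Type} [Finite S] [Nonempty S] (plan : S → Plan m)
    {n N K : ℕ} (hN : 1 ≤ N) (hK : 2 ≤ K) :
    (Plan.protocol plan n N).MessagesAtMost N (K * Nat.size N) := by
  intro s _ i _ h q x hx
  obtain ⟨k, hk, rfl⟩ := Plan.message_eq_num hx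
  have h1 : 0 < Nat.size N := Nat.size_pos.2 hN
  have h2 := Nat.size_le_size hk
  have h3 := Nat.mul_le_mul_right (Nat.size N) hK
  simp only [Msg.bits]
  omega

end ByzRenaming

/-! ### Executions under a good plan -/

namespace ByzRenaming

open scoped Classical

namespace Plan

variable {n N m : ℕ}

/-- All that the analysis uses about an execution in which `W v` is the view of node `v`: senders
are authenticated, and correct nodes follow the protocol, up to the last round. -/
structure IsRun (p : Plan m) (G : Network n N) (W : Fin n → View n) : Prop where
  auth : ∀ v r q x, W v r q = some x → x.1 = G.ident (G.port v q)
  correct : ∀ u ∉ G.byz, ∀ v, ∀ r ≤ p.lastRound, W v r ((G.port v).symm u) =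
    (p.message N (W u) (G.ident u) r ((G.port u).symm v)).map (Prod.mk (G.ident u))

/-- The random choices are favourable: in every bucket, more than `2 * bound` nodes are correct,
at most `bound` are Byzantine, and there are at most `slots` altogether; and in some phase exactly
one hub is king, and it is correct. -/
structure Good (p : Plan m) (G : Network n N) : Prop where
  many_correct : ∀ B, 2 * p.bound <
    (Finset.univ.filter fun u => u ∉ G.byz ∧ p.bucket (G.ident u) = B).card
  few_byz : ∀ B, (Finset.univ.filter fun u => u ∈ G.byz ∧ p.bucket (G.ident u) = B).card ≤ p.bound
  small : ∀ B, (Finset.univ.filter fun u => p.bucket (G.ident u) = B).card ≤ p.slots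
  king : ∃ j < p.phases, ∃ κ ∉ G.byz, p.bucket (G.ident κ) = 0 ∧ p.king j (G.ident κ) ∧
    ∀ u, p.bucket (G.ident u) = 0 → p.king j (G.ident u) → u = κ

variable {p : Plan m} {G : Network n N} {W : Fin n → View n}

lemma card_ports (v : Fin n) (Q : Fin n → Prop) [DecidablePred Q] :
    (Finset.univ.filter Q).card = (Finset.univ.filter fun u => Q ((G.port v).symm u)).card := by
  refine Finset.card_bij (fun q _ => G.port v q) ?_ ?_ ?_
  · intro q hq
    simpa using hq
  · intro q _ q' _ h
    exact (G.port v).injective h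
  · intro u hu
    exact ⟨(G.port v).symm u, by simpa using hu, by simp⟩

/-- Number of the correct members of bucket `B` with property `A`. -/
noncomputable def tally (p : Plan m) (G : Network n N) (B : Fin (m + 1)) (A : Fin n → Prop) : ℕ :=
  (Finset.univ.filter fun u => u ∉ G.byz ∧ p.bucket (G.ident u) = B ∧ A u).card

lemma tally_le_count {B : Fin (m + 1)} {v : Fin n} {Q A : Fin n → Prop}
    [DecidablePred Q]
    (hA : ∀ u ∉ G.byz, p.bucket (G.ident u) = B → (Q ((G.port v).symm u) ↔ A u)) :
    p.tally G B A ≤ (Finset.univ.filter Q).card := by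
  rw [card_ports v Q (G := G)]
  refine Finset.card_le_card fun u hu => ?_
  simp only [Finset.mem_filter, Finset.mem_univ, true_and] at hu ⊢
  exact (hA u hu.1 hu.2.1).2 hu.2.2

lemma count_le_tally (hG : p.Good G) {B : Fin (m + 1)} {v : Fin n} {Q A : Fin n → Prop}
    [DecidablePred Q]
    (hQ : ∀ u, Q ((G.port v).symm u) → p.bucket (G.ident u) = B)
    (hA : ∀ u ∉ G.byz, p.bucket (G.ident u) = B → (Q ((G.port v).symm u) ↔ A u)) :
    (Finset.univ.filter Q).card ≤ p.tally G B A + p.bound := by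
  rw [card_ports v Q (G := G)]
  refine le_trans ?_ (Nat.add_le_add_left (hG.few_byz B) _)
  refine le_trans (Finset.card_le_card ?_) (Finset.card_union_le _ _)
  intro u hu
  simp only [Finset.mem_filter, Finset.mem_univ, true_and, Finset.mem_union] at hu ⊢
  by_cases h : u ∈ G.byz
  · exact Or.inr ⟨h, hQ u hu⟩
  · exact Or.inl ⟨h, hQ u hu, (hA u h (hQ u hu)).1 hu⟩

lemma lt_tally (hG : p.Good G) {B : Fin (m + 1)} {A : Fin n → Prop}
    (hA : ∀ u ∉ G.byz, p.bucket (G.ident u) = B → A u) : 2 * p.bound < p.tally G B A := by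
  refine (hG.many_correct B).trans_le (Finset.card_le_card fun u hu => ?_)
  simp only [Finset.mem_filter, Finset.mem_univ, true_and] at hu ⊢
  exact ⟨hu.1, hu.2, hA u hu.1 hu.2⟩

lemma exists_of_tally_pos {B : Fin (m + 1)} {A : Fin n → Prop} (h : 0 < p.tally G B A) :
    ∃ u ∉ G.byz, p.bucket (G.ident u) = B ∧ A u := by
  obtain ⟨u, hu⟩ := Finset.card_pos.1 h
  simp only [Finset.mem_filter, Finset.mem_univ, true_and] at hu
  exact ⟨u, hu⟩

/-- At most `slots` topics of one bucket belong to identities of nodes. -/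
lemma card_le_slots (hG : p.Good G) {B : Fin (m + 1)} {T : Finset ℕ}
    (hT : ∀ k ∈ T, p.bucket k = B ∧ ∃ w, G.ident w = k) : T.card ≤ p.slots := by
  refine le_trans ?_ (hG.small B)
  refine le_trans (Finset.card_le_card ?_) (Finset.card_image_le (f := G.ident))
  intro k hk
  obtain ⟨h, w, rfl⟩ := hT k hk
  exact Finset.mem_image_of_mem _ (by simpa using h)

namespace IsRun

variable (hW : p.IsRun G W)
include hW

lemma hubPort_bucket {v u : Fin n} (h : p.HubPort (W v) ((G.port v).symm u)) :
    p.bucket (G.ident u) = 0 := by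
  obtain ⟨x, hx, hb⟩ := h
  have := hW.auth v 0 _ x hx
  rw [Equiv.apply_symm_apply] at this
  rwa [← this]

lemma peerIn_bucket {v u : Fin n} {B : Fin (m + 1)} (h : p.PeerIn (W v) ((G.port v).symm u) B) :
    p.bucket (G.ident u) = B := by
  obtain ⟨x, hx, hb⟩ := h
  have := hW.auth v 1 _ x hx
  rw [Equiv.apply_symm_apply] at this
  rwa [← this]

lemma hubPort {u : Fin n} (hu : u ∉ G.byz) (hb : p.bucket (G.ident u) = 0) (v : Fin n) :
    p.HubPort (W v) ((G.port v).symm u) := by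
  refine ⟨(G.ident u, .num 0), ?_, hb⟩
  rw [hW.correct u hu v 0 (Nat.zero_le _)]
  simp [message, hb]

lemma report {u v : Fin n} (hu : u ∉ G.byz) (hv : v ∉ G.byz) (hb : p.bucket (G.ident v) = 0) :
    W v 1 ((G.port v).symm u) = some (G.ident u, .num 0) := by
  rw [hW.correct u hu v 1 (by unfold lastRound; omega)]
  simp [message, hW.hubPort hv hb u]

lemma peerIn {u v : Fin n} (hu : u ∉ G.byz) (hv : v ∉ G.byz) (hb : p.bucket (G.ident v) = 0)
    {B : Fin (m + 1)} : p.PeerIn (W v) ((G.port v).symm u) B ↔ p.bucket (G.ident u) = B :=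
  ⟨hW.peerIn_bucket, fun h => ⟨_, hW.report hu hv hb, h⟩⟩

lemma holds_zero {v : Fin n} {k : ℕ} (h : p.Holds (W v) 0 k) : ∃ w, G.ident w = k := by
  obtain ⟨q, x, hx, rfl⟩ := h
  exact ⟨_, (hW.auth v 1 q x hx).symm⟩

lemma holds_zero_of_correct {u v : Fin n} (hu : u ∉ G.byz) (hv : v ∉ G.byz)
    (hb : p.bucket (G.ident v) = 0) : p.Holds (W v) 0 (G.ident u) :=
  ⟨_, _, hW.report hu hv hb, rfl⟩

lemma slot {u : Fin n} (hu : u ∉ G.byz) (v : Fin n) {τ s : ℕ} (hτ : τ < 5 * p.phases)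
    (hs : s < p.slots) : W v (2 + τ * p.slots + s) ((G.port v).symm u) =
      ((p.topics N (W u) (G.ident u) τ ((G.port u).symm v)).toList[s]?).map
        fun k => (G.ident u, .num k) := by
  have hlt : 2 + τ * p.slots + s < p.lastRound := by
    have := Nat.mul_le_mul_right p.slots (Nat.succ_le_of_lt hτ)
    rw [Nat.succ_mul] at this
    unfold lastRound
    omega
  rw [hW.correct u hu v _ hlt.le]
  have h1 : (2 + τ * p.slots + s - 2) / p.slots = τ := by
    rw [show 2 + τ * p.slots + s - 2 = s + p.slots * τ by rw [mul_comm]; omega,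
      Nat.add_mul_div_left _ _ (by omega), Nat.div_eq_of_lt hs, zero_add]
  have h2 : (2 + τ * p.slots + s - 2) % p.slots = s := by
    rw [show 2 + τ * p.slots + s - 2 = s + p.slots * τ by rw [mul_comm]; omega,
      Nat.add_mul_mod_self_left, Nat.mod_eq_of_lt hs]
  unfold message
  rw [if_neg (by omega), if_neg (by omega), if_pos hlt, h1, h2, Option.map_map]
  rfl

lemma heard_mem {u v : Fin n} (hu : u ∉ G.byz) {τ k : ℕ} (hτ : τ < 5 * p.phases)
    (h : p.Heard (W v) τ ((G.port v).symm u) k) :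
    k ∈ p.topics N (W u) (G.ident u) τ ((G.port u).symm v) := by
  obtain ⟨s, hs, i, hi⟩ := h
  rw [hW.slot hu v hτ hs, Option.map_eq_some_iff] at hi
  obtain ⟨k', hk', he⟩ := hi
  obtain rfl : k' = k := by simpa using congrArg Prod.snd he
  exact Finset.mem_toList.1 (List.mem_of_getElem? hk')

/-- The topics of a block arrive if there are enough slots for them. -/
lemma mem_heard {u v : Fin n} (hu : u ∉ G.byz) {τ k : ℕ} (hτ : τ < 5 * p.phases)
    (hc : (p.topics N (W u) (G.ident u) τ ((G.port u).symm v)).card ≤ p.slots)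
    (h : k ∈ p.topics N (W u) (G.ident u) τ ((G.port u).symm v)) :
    p.Heard (W v) τ ((G.port v).symm u) k := by
  obtain ⟨s, hs⟩ := List.mem_iff_getElem?.1 (Finset.mem_toList.2 h)
  have hlt : s < p.slots := by
    obtain ⟨h', -⟩ := List.getElem?_eq_some_iff.1 hs
    rw [Finset.length_toList] at h'
    omega
  refine ⟨s, hlt, G.ident u, ?_⟩
  rw [hW.slot hu v hτ hlt, hs]
  rfl

omit hW in
lemma mem_topics {V : View n} {i j a k : ℕ} {q : Fin n} (ha : a < 5) :
    k ∈ p.topics N V i (5 * j + a) q ↔ k ∈ Finset.Icc 1 N ∧ p.Says V i j q k a := by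
  have h1 : (5 * j + a) / 5 = j := by omega
  have h2 : (5 * j + a) % 5 = a := by omega
  simp only [topics, Finset.mem_filter, h1, h2]

/-- If everything that a correct node says to a node in a block is on identities of nodes in one
bucket, then this is what that node hears. -/
lemma heard_iff (hG : p.Good G) {u v : Fin n} (hu : u ∉ G.byz) {j a k : ℕ} (hj : j < p.phases)
    (ha : a < 5) {B : Fin (m + 1)} (hB : ∀ k, p.Says (W u) (G.ident u) j ((G.port u).symm v) k a →
      p.bucket k = B ∧ ∃ w, G.ident w = k) :
    p.Heard (W v) (5 * j + a) ((G.port v).symm u) k ↔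
      p.Says (W u) (G.ident u) j ((G.port u).symm v) k a := by
  constructor
  · intro h
    exact ((mem_topics ha).1 (hW.heard_mem hu (by omega) h)).2
  · intro h
    refine hW.mem_heard hu (by omega) (card_le_slots hG (B := B) fun k' hk' =>
      hB k' ((mem_topics ha).1 hk').2) ((mem_topics ha).2 ⟨?_, h⟩)
    obtain ⟨-, w, rfl⟩ := hB k h
    exact Finset.mem_Icc.2 (G.ident_mem w)

end IsRun

/-- When phase `j` begins, the correct hubs hold only identities of nodes. -/
def Genuine (p : Plan m) (G : Network n N) (W : Fin n → View n) (j : ℕ) : Prop :=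
  ∀ u ∉ G.byz, p.bucket (G.ident u) = 0 → ∀ k, p.Holds (W u) j k → ∃ w, G.ident w = k

section Phase

variable (hW : p.IsRun G W) (hG : p.Good G) {j : ℕ} (hj : j < p.phases)
  (hR : p.Genuine G W j)
include hW hG hj hR

lemma heard_holds {u v : Fin n} {k : ℕ} (hu : u ∉ G.byz) (hv : v ∉ G.byz)
    (hb : p.bucket (G.ident u) = 0) (hk : p.bucket (G.ident v) = p.bucket k) :
    p.Heard (W v) (5 * j) ((G.port v).symm u) k ↔ p.Holds (W u) j k := by
  rw [← Nat.add_zero (5 * j), hW.heard_iff hG hu hj (by norm_num) (B := p.bucket (G.ident v))]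
  · simp [Says, hb, hW.peerIn hv hu hb, hk]
  · rintro k' ⟨-, h1, h2⟩
    exact ⟨(hW.peerIn_bucket h1).symm, hR u hu hb k' h2⟩

lemma tally_le_votes {v : Fin n} {k : ℕ} (hv : v ∉ G.byz)
    (hk : p.bucket (G.ident v) = p.bucket k) :
    p.tally G 0 (fun u => p.Holds (W u) j k) ≤ p.votes (W v) j k := by
  unfold votes
  refine tally_le_count (v := v) fun u hu hb => ?_
  rw [heard_holds hW hG hj hR hu hv hb hk]
  exact and_iff_right (hW.hubPort hu hb v)

lemma votes_le_tally {v : Fin n} {k : ℕ} (hv : v ∉ G.byz)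
    (hk : p.bucket (G.ident v) = p.bucket k) :
    p.votes (W v) j k ≤ p.tally G 0 (fun u => p.Holds (W u) j k) + p.bound := by
  unfold votes
  refine count_le_tally hG (v := v) (fun u h => hW.hubPort_bucket h.1) fun u hu hb => ?_
  rw [heard_holds hW hG hj hR hu hv hb hk]
  exact and_iff_right (hW.hubPort hu hb v)

lemma exists_node_of_votes {v : Fin n} {k : ℕ} (hv : v ∉ G.byz)
    (hk : p.bucket (G.ident v) = p.bucket k) (h : p.bound < p.votes (W v) j k) :
    ∃ w, G.ident w = k := by
  have := votes_le_tally hW hG hj hR hv hk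
  obtain ⟨u, hu, hb, hh⟩ := exists_of_tally_pos (p := p) (G := G) (B := 0)
    (A := fun u => p.Holds (W u) j k) (by omega)
  exact hR u hu hb k hh

lemma heard_votes {u v : Fin n} {k a : ℕ} (hu : u ∉ G.byz) (hv : v ∉ G.byz)
    (hb : p.bucket (G.ident v) = 0) (hk : p.bucket (G.ident u) = p.bucket k)
    (ha : a = 1 ∨ a = 2) : p.Heard (W v) (5 * j + a) ((G.port v).symm u) k ↔
      a * p.bound < p.votes (W u) j k := by
  rw [hW.heard_iff hG hu hj (by omega) (B := p.bucket (G.ident u))]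
  · rcases ha with rfl | rfl
    · simp [Says, hk, hW.hubPort hv hb]
    · simp [Says, hk, hW.hubPort hv hb]
  · rcases ha with rfl | rfl
    · rintro k' ⟨-, h1, h2⟩
      exact ⟨h1.symm, exists_node_of_votes hW hG hj hR hu h1 h2⟩
    · rintro k' ⟨-, h1, h2⟩
      exact ⟨h1.symm, exists_node_of_votes hW hG hj hR hu h1 (by omega)⟩

lemma tally_le_reports {v : Fin n} {k a : ℕ} (hv : v ∉ G.byz) (hb : p.bucket (G.ident v) = 0)
    (ha : a = 1 ∨ a = 2) :
    p.tally G (p.bucket k) (fun u => a * p.bound < p.votes (W u) j k) ≤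
      p.reports (W v) (5 * j + a) k := by
  unfold reports
  refine tally_le_count (v := v) fun u hu hk => ?_
  rw [heard_votes hW hG hj hR hu hv hb hk ha]
  exact and_iff_right ((hW.peerIn hu hv hb).2 hk)

lemma reports_le_tally {v : Fin n} {k a : ℕ} (hv : v ∉ G.byz) (hb : p.bucket (G.ident v) = 0)
    (ha : a = 1 ∨ a = 2) : p.reports (W v) (5 * j + a) k ≤
      p.tally G (p.bucket k) (fun u => a * p.bound < p.votes (W u) j k) + p.bound := by
  unfold reports
  refine count_le_tally hG (v := v) (fun u h => hW.peerIn_bucket h.1) fun u hu hk => ?_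
  rw [heard_votes hW hG hj hR hu hv hb hk ha]
  exact and_iff_right ((hW.peerIn hu hv hb).2 hk)

/-- What all correct hubs hold, they continue to hold. -/
lemma holds_succ_of_forall {k : ℕ}
    (h : ∀ u ∉ G.byz, p.bucket (G.ident u) = 0 → p.Holds (W u) j k) {c : Fin n} (hc : c ∉ G.byz)
    (hb : p.bucket (G.ident c) = 0) : p.Holds (W c) (j + 1) k := by
  refine Or.inl ((lt_tally hG fun u hu hk => ?_).trans_le
    (tally_le_reports hW hG hj hR hc hb (Or.inr rfl)))
  exact (lt_tally hG h).trans_le (tally_le_votes hW hG hj hR hu hk)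

/-- If one correct member of the bucket of `k` has seen more than `2 * bound` votes for `k`, then
more than `bound` of them are votes of correct hubs, so that all correct members have seen more than
`bound` votes, and report so. -/
lemma bound_lt_reports {k : ℕ} {w c : Fin n} (hw : w ∉ G.byz)
    (hk : p.bucket (G.ident w) = p.bucket k) (h : 2 * p.bound < p.votes (W w) j k)
    (hc : c ∉ G.byz) (hb : p.bucket (G.ident c) = 0) :
    p.bound < p.reports (W c) (5 * j + 1) k := by
  have h1 := votes_le_tally hW hG hj hR hw hk
  have h2 := tally_le_reports hW hG hj hR (k := k) hc hb (Or.inl rfl)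
  have h3 := lt_tally hG (B := p.bucket k) (A := fun u => 1 * p.bound < p.votes (W u) j k)
    fun u hu hk => by
      have := tally_le_votes hW hG hj hR hu hk
      omega
  omega

lemma exists_votes_of_reports {k a : ℕ} {c : Fin n} (hc : c ∉ G.byz)
    (hb : p.bucket (G.ident c) = 0) (ha : a = 1 ∨ a = 2)
    (h : p.bound < p.reports (W c) (5 * j + a) k) :
    ∃ w ∉ G.byz, p.bucket (G.ident w) = p.bucket k ∧ a * p.bound < p.votes (W w) j k := by
  have := reports_le_tally hW hG hj hR (k := k) hc hb ha
  exact exists_of_tally_pos (by omega)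

/-- What no correct hub holds, they do not take up. -/
lemma not_holds_succ_of_forall {k : ℕ}
    (h : ∀ u ∉ G.byz, p.bucket (G.ident u) = 0 → ¬ p.Holds (W u) j k) {c : Fin n}
    (hc : c ∉ G.byz) (hb : p.bucket (G.ident c) = 0) : ¬ p.Holds (W c) (j + 1) k := by
  have key : ∀ a, a = 1 ∨ a = 2 → ¬ p.bound < p.reports (W c) (5 * j + a) k := by
    intro a ha hlt
    obtain ⟨w, hw, hk, hv⟩ := exists_votes_of_reports hW hG hj hR hc hb ha hlt
    have := votes_le_tally hW hG hj hR hw hk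
    have hpos : 0 < p.tally G 0 (fun u => p.Holds (W u) j k) := by
      rcases ha with rfl | rfl <;> omega
    obtain ⟨u, hu, hb', hh⟩ := exists_of_tally_pos hpos
    exact h u hu hb' hh
  rintro (h2 | ⟨h1, -⟩)
  · exact key 2 (Or.inr rfl) (by omega)
  · exact key 1 (Or.inl rfl) h1

lemma genuine_succ : p.Genuine G W (j + 1) := by
  intro c hc hb k hk
  by_contra hno
  exact not_holds_succ_of_forall hW hG hj hR (fun u hu hb' h => hno (hR u hu hb' k h)) hc hb hk

section King

variable {κ : Fin n} (hκ : κ ∉ G.byz) (hκb : p.bucket (G.ident κ) = 0)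
  (hking : p.king j (G.ident κ))
  (huniq : ∀ u, p.bucket (G.ident u) = 0 → p.king j (G.ident u) → u = κ)
include hκ hκb hking

lemma heard_king {w : Fin n} {k : ℕ} (hw : w ∉ G.byz)
    (hk : p.bucket (G.ident w) = p.bucket k) :
    p.Heard (W w) (5 * j + 3) ((G.port w).symm κ) k ↔
      p.bound < p.reports (W κ) (5 * j + 2) k := by
  rw [hW.heard_iff hG hκ hj (by norm_num) (B := p.bucket (G.ident w))]
  · simp [Says, hκb, hking, hW.peerIn hw hκ hκb, hk]
  · rintro k' ⟨-, -, h1, h2⟩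
    obtain ⟨w', hw', hk', hv⟩ := exists_votes_of_reports hW hG hj hR hκ hκb (Or.inr rfl) h2
    exact ⟨(hW.peerIn_bucket h1).symm,
      exists_node_of_votes hW hG hj hR hw' hk' (by omega)⟩

include huniq

lemma says_king {w : Fin n} {k : ℕ} {q : Fin n} (hw : w ∉ G.byz) :
    p.Says (W w) (G.ident w) j q k 4 ↔ p.HubPort (W w) q ∧
      p.bucket (G.ident w) = p.bucket k ∧ p.bound < p.reports (W κ) (5 * j + 2) k := by
  constructor
  · rintro ⟨h1, h2, q', x, hx, hxb, hxk, hh⟩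
    rw [hW.auth w 0 q' x hx] at hxb hxk
    have hq : q' = (G.port w).symm κ := by
      rw [← huniq _ hxb hxk, Equiv.symm_apply_apply]
    rw [hq, heard_king hW hG hj hR hκ hκb hking hw h2] at hh
    exact ⟨h1, h2, hh⟩
  · rintro ⟨h1, h2, h3⟩
    obtain ⟨x, hx, hxb⟩ := hW.hubPort hκ hκb w
    have hid := hW.auth w 0 _ x hx
    rw [Equiv.apply_symm_apply] at hid
    exact ⟨h1, h2, _, x, hx, hxb, by rwa [hid],
      (heard_king hW hG hj hR hκ hκb hking hw h2).2 h3⟩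

/-- In a phase with a unique king that is correct, the members of a bucket pass on to the hubs what
the king has seen. -/
lemma heard_relay {w c : Fin n} {k : ℕ} (hw : w ∉ G.byz) (hc : c ∉ G.byz)
    (hb : p.bucket (G.ident c) = 0) (hk : p.bucket (G.ident w) = p.bucket k) :
    p.Heard (W c) (5 * j + 4) ((G.port c).symm w) k ↔
      p.bound < p.reports (W κ) (5 * j + 2) k := by
  have hs := fun k => says_king hW hG hj hR hκ hκb hking huniq (k := k)
    (q := (G.port w).symm c) hw
  rw [hW.heard_iff hG hw hj (by norm_num) (B := p.bucket (G.ident w)), hs]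
  · simp [hk, hW.hubPort hc hb]
  · intro k' hk'
    obtain ⟨-, h1, h2⟩ := (hs k').1 hk'
    obtain ⟨w', hw', hk', hv⟩ := exists_votes_of_reports hW hG hj hR hκ hκb (Or.inr rfl) h2
    exact ⟨h1.symm, exists_node_of_votes hW hG hj hR hw' hk' (by omega)⟩

/-- A correct unique king brings agreement: if some correct hub takes `k` on, with or without the
king, then the king is in favour, which entails that all correct hubs get enough first reports to
follow it. -/
lemma holds_succ_of_king {k : ℕ} {c c' : Fin n} (hc : c ∉ G.byz) (hb : p.bucket (G.ident c) = 0)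
    (hc' : c' ∉ G.byz) (hb' : p.bucket (G.ident c') = 0) (h : p.Holds (W c) (j + 1) k) :
    p.Holds (W c') (j + 1) k := by
  have hA : ∀ c ∉ G.byz, p.bucket (G.ident c) = 0 → ∀ u ∉ G.byz,
      p.bucket (G.ident u) = p.bucket k →
      (p.PeerIn (W c) ((G.port c).symm u) (p.bucket k) ∧
        p.Heard (W c) (5 * j + 4) ((G.port c).symm u) k ↔
          p.bound < p.reports (W κ) (5 * j + 2) k) := by
    intro c hc hb u hu hk
    rw [heard_relay hW hG hj hR hκ hκb hking huniq hu hc hb hk]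
    exact and_iff_right ((hW.peerIn hu hc hb).2 hk)
  have hkey : p.bound < p.reports (W κ) (5 * j + 2) k := by
    -- The tallies of second reports are common to all hubs, so that more than `2 * bound` at one
    -- hub are more than `bound` at the king.
    rcases h with h2 | ⟨-, h4⟩
    · have h5 := reports_le_tally hW hG hj hR (k := k) hc hb (Or.inr rfl)
      have h6 := tally_le_reports hW hG hj hR (k := k) hκ hκb (Or.inr rfl)
      omega
    · have : p.reports (W c) (5 * j + 4) k ≤ p.tally G (p.bucket k)
          (fun _ => p.bound < p.reports (W κ) (5 * j + 2) k) + p.bound := by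
        unfold reports
        exact count_le_tally hG (v := c) (fun u h => hW.peerIn_bucket h.1) (hA c hc hb)
      obtain ⟨_, _, _, h⟩ := exists_of_tally_pos (p := p) (G := G) (B := p.bucket k)
        (A := fun _ => p.bound < p.reports (W κ) (5 * j + 2) k) (by omega)
      exact h
  right
  constructor
  · obtain ⟨w, hw, hk, hv⟩ := exists_votes_of_reports hW hG hj hR hκ hκb (Or.inr rfl) hkey
    exact bound_lt_reports hW hG hj hR hw hk hv hc' hb'
  · have h1 : p.tally G (p.bucket k) (fun _ => p.bound < p.reports (W κ) (5 * j + 2) k) ≤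
        p.reports (W c') (5 * j + 4) k := by
      unfold reports
      exact tally_le_count (v := c') (hA c' hc' hb')
    have h2 := lt_tally hG (B := p.bucket k)
      (A := fun _ => p.bound < p.reports (W κ) (5 * j + 2) k) fun _ _ _ => hkey
    omega

end King

end Phase

end Plan

end ByzRenaming

/-! ### Agreement of the hubs and the new identities -/

namespace ByzRenaming

open scoped Classical

namespace Plan

variable {n N m : ℕ} {p : Plan m} {G : Network n N} {W : Fin n → View n}

section Outcome

variable (hW : p.IsRun G W) (hG : p.Good G)
include hW hG

lemma genuine {j : ℕ} (hj : j ≤ p.phases) : p.Genuine G W j := by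
  induction j with
  | zero => exact fun u _ _ k hk => hW.holds_zero hk
  | succ j ih => exact genuine_succ hW hG hj (ih (by omega))

lemma holds_ident {j : ℕ} (hj : j ≤ p.phases) {v c : Fin n} (hv : v ∉ G.byz) (hc : c ∉ G.byz)
    (hb : p.bucket (G.ident c) = 0) : p.Holds (W c) j (G.ident v) := by
  induction j generalizing c with
  | zero => exact hW.holds_zero_of_correct hv hc hb
  | succ j ih =>
    exact holds_succ_of_forall hW hG hj (genuine hW hG (by omega))
      (fun u hu hb => ih (by omega) hu hb) hc hb

/-- In the end all correct hubs hold the same identities: they agree after the phase with the good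
king, and agreement persists. -/
lemma holds_agree {k : ℕ} {c c' : Fin n} (hc : c ∉ G.byz) (hb : p.bucket (G.ident c) = 0)
    (hc' : c' ∉ G.byz) (hb' : p.bucket (G.ident c') = 0) (h : p.Holds (W c) p.phases k) :
    p.Holds (W c') p.phases k := by
  obtain ⟨j₀, hj₀, κ, hκ, hκb, hking, huniq⟩ := hG.king
  suffices ∀ j, j₀ + 1 ≤ j → j ≤ p.phases → ∀ c ∉ G.byz, p.bucket (G.ident c) = 0 →
      ∀ c' ∉ G.byz, p.bucket (G.ident c') = 0 → p.Holds (W c) j k → p.Holds (W c') j k from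
    this _ hj₀ le_rfl c hc hb c' hc' hb' h
  intro j hj
  induction j, hj using Nat.le_induction with
  | base =>
    intro _ c hc hb c' hc' hb' h
    exact holds_succ_of_king hW hG hj₀ (genuine hW hG hj₀.le) hκ hκb hking huniq hc hb hc' hb' h
  | succ j hj ih =>
    intro hle c hc hb c' hc' hb' h
    have hR := genuine hW hG (j := j) (by omega)
    by_cases hex : ∃ u ∉ G.byz, p.bucket (G.ident u) = 0 ∧ p.Holds (W u) j k
    · obtain ⟨u, hu, hub, huk⟩ := hex
      exact holds_succ_of_forall hW hG hle hR
        (fun u' hu' hb' => ih (by omega) u hu hub u' hu' hb' huk) hc' hb'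
    · push Not at hex
      exact absurd h (not_holds_succ_of_forall hW hG hle hR hex hc hb)

/-- The new identities are the ranks in a set of identities of nodes that contains those of all
correct nodes. -/
lemma exists_newName : ∃ S : Finset ℕ, (∀ k ∈ S, ∃ w, G.ident w = k) ∧
    (∀ v ∉ G.byz, G.ident v ∈ S) ∧
    ∀ v ∉ G.byz, p.newName (W v) = (S.filter (· ≤ G.ident v)).card := by
  obtain ⟨c₀, hc₀⟩ := Finset.card_pos.1 ((Nat.zero_le _).trans_lt (hG.many_correct 0))
  simp only [Finset.mem_filter, Finset.mem_univ, true_and] at hc₀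
  refine ⟨(Finset.Icc 1 N).filter fun k => p.Holds (W c₀) p.phases k, ?_, ?_, ?_⟩
  · intro k hk
    exact genuine hW hG le_rfl c₀ hc₀.1 hc₀.2 k (Finset.mem_filter.1 hk).2
  · intro v hv
    exact Finset.mem_filter.2 ⟨Finset.mem_Icc.2 (G.ident_mem v),
      holds_ident hW hG le_rfl hv hc₀.1 hc₀.2⟩
  intro v hv
  set R := (((Finset.Icc 1 N).filter fun k => p.Holds (W c₀) p.phases k).filter
    (· ≤ G.ident v)).card with hR
  have hrank : ∀ c ∉ G.byz, p.bucket (G.ident c) = 0 → p.rank N (W c) (G.ident v) = R := by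
    intro c hc hb
    rw [hR, rank, Finset.filter_filter]
    congr 1
    refine Finset.filter_congr fun k _ => ?_
    rw [and_comm]
    exact and_congr_left' ⟨holds_agree hW hG hc hb hc₀.1 hc₀.2,
      holds_agree hW hG hc₀.1 hc₀.2 hc hb⟩
  have hlast : ∀ c ∉ G.byz, p.bucket (G.ident c) = 0 →
      W v p.lastRound ((G.port v).symm c) = some (G.ident c, .num R) := by
    intro c hc hb
    rw [hW.correct c hc v _ le_rfl, message, if_neg (by unfold lastRound; omega),
      if_neg (by unfold lastRound; omega), if_neg (lt_irrefl _), if_pos hb, hW.report hv hc hb]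
    simp [hrank c hc hb]
  have hA : ∀ k, ∀ c ∉ G.byz, p.bucket (G.ident c) = 0 →
      (p.HubPort (W v) ((G.port v).symm c) ∧
        (∃ i, W v p.lastRound ((G.port v).symm c) = some (i, .num k)) ↔ R = k) := by
    intro k c hc hb
    rw [hlast c hc hb]
    simp [hW.hubPort hc hb]
  have hset : {k | p.bound < p.announcements (W v) k} = {R} := by
    ext k
    simp only [Set.mem_ofPred_eq, Set.mem_singleton_iff]
    constructor
    · intro hk
      have h1 : p.announcements (W v) k ≤ p.tally G 0 (fun _ => R = k) + p.bound := by
        unfold announcements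
        exact count_le_tally hG (v := v) (fun u h => hW.hubPort_bucket h.1) (hA k)
      obtain ⟨_, _, _, h⟩ := exists_of_tally_pos (p := p) (G := G) (B := 0)
        (A := fun _ => R = k) (by omega)
      exact h.symm
    · rintro rfl
      have h1 : p.tally G 0 (fun _ => R = R) ≤ p.announcements (W v) R := by
        unfold announcements
        exact tally_le_count (v := v) (hA R)
      have h2 := lt_tally hG (B := 0) (A := fun _ => R = R) fun _ _ _ => rfl
      omega
  rw [newName, hset, csInf_singleton]

lemma isStrongOrderPreserving_newName :
    IsStrongOrderPreserving G fun v => p.newName (W v) := by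
  obtain ⟨S, hS, hmem, hname⟩ := exists_newName hW hG
  have hcard : S.card ≤ n := by
    calc S.card ≤ (Finset.univ.image G.ident).card := Finset.card_le_card fun k hk => by
          obtain ⟨w, rfl⟩ := hS k hk
          exact Finset.mem_image_of_mem _ (Finset.mem_univ w)
      _ ≤ n := Finset.card_image_le.trans (by simp)
  have hlt : ∀ u ∉ G.byz, ∀ v ∉ G.byz, G.ident u < G.ident v →
      p.newName (W u) < p.newName (W v) := by
    intro u hu v hv huv
    rw [hname u hu, hname v hv]
    refine Finset.card_lt_card ⟨fun k hk => ?_, fun h => ?_⟩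
    · rw [Finset.mem_filter] at hk ⊢
      exact ⟨hk.1, hk.2.trans huv.le⟩
    · have := h (Finset.mem_filter.2 ⟨hmem v hv, le_rfl⟩)
      exact absurd (Finset.mem_filter.1 this).2 (by omega)
  refine ⟨fun v hv => ?_, fun u hu v hv h => ?_, hlt⟩
  · change p.newName (W v) ∈ _
    rw [hname v hv]
    exact ⟨Finset.card_pos.2 ⟨_, Finset.mem_filter.2 ⟨hmem v hv, le_rfl⟩⟩,
      (Finset.card_filter_le _ _).trans hcard⟩
  · rcases lt_trichotomy (G.ident u) (G.ident v) with h' | h' | h'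
    · exact absurd h (hlt u hu v hv h').ne
    · exact G.ident_injective h'
    · exact absurd h (hlt v hv u hu h').ne'

end Outcome

/-- Only hubs send messages to others than hubs. -/
lemma hub_of_message {V : View n} {i r : ℕ} {q : Fin n} {x : Msg}
    (h : p.message N V i r q = some x) : p.bucket i = 0 ∨ p.HubPort V q := by
  unfold message at h
  split_ifs at h with _ hb _ hq _ hb
  · exact Or.inl hb
  · exact Or.inr hq
  · obtain ⟨k, hk, -⟩ := Option.map_eq_some_iff.1 h
    have hk := (Finset.mem_filter.1 (Finset.mem_toList.1 (List.mem_of_getElem? hk))).2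
    have ha : (r - 2) / p.slots % 5 < 5 := Nat.mod_lt _ (by norm_num)
    generalize (r - 2) / p.slots % 5 = a at hk ha
    interval_cases a
    · exact Or.inl hk.1
    · exact Or.inr hk.1
    · exact Or.inr hk.1
    · exact Or.inl hk.1
    · exact Or.inr hk.1
  · exact Or.inl hb

end Plan

/-! ### The protocol in an execution -/

/-- The inboxes of `v` in all rounds of an execution. -/
def inboxes {n N : ℕ} (P : Protocol n) (G : Network n N) (ω : P.Coins) (b : Behaviour n)
    (v : Fin n) : View n :=
  fun r q => (sent P G ω b r (G.port v q) v).map (Prod.mk (G.ident (G.port v q)))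

lemma history_eq {n N : ℕ} (P : Protocol n) (G : Network n N) (ω : P.Coins) (b : Behaviour n)
    (t : ℕ) (v : Fin n) : history P G ω b t v = (List.range t).map (inboxes P G ω b v) := by
  induction t with
  | zero => rfl
  | succ t ih =>
    rw [List.range_succ, List.map_append, ← ih]
    rfl

lemma viewOf_history {n N : ℕ} (P : Protocol n) (G : Network n N) (ω : P.Coins) (b : Behaviour n)
    (v : Fin n) {r t : ℕ} (hr : r < t) :
    viewOf (history P G ω b t v) r = inboxes P G ω b v r := by
  simp [viewOf, history_eq, List.getD, hr]

namespace Plan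

variable {n N m : ℕ} {S : Type} [Finite S] [Nonempty S] (plan : S → Plan m) (G : Network n N)
  (ω : (Plan.protocol plan n N).Coins) (b : Behaviour n)

lemma sent_eq {r : ℕ} (hr : r ≤ (plan ω.1).lastRound) {u : Fin n} (hu : u ∉ G.byz) (v : Fin n) :
    sent (Plan.protocol plan n N) G ω b r u v =
      (plan ω.1).message N (inboxes (Plan.protocol plan n N) G ω b u) (G.ident u) r
        ((G.port u).symm v) := by
  have hlen : (history (Plan.protocol plan n N) G ω b r u).length = r := by
    simp [history_eq]
  have hnone : (Plan.protocol plan n N).decision ω.1 (ω.2 u) (G.ident u)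
      (history (Plan.protocol plan n N) G ω b r u) = none := by
    refine List.findSome?_eq_none_iff.2 fun h hh => if_neg ?_
    have := (List.mem_inits _ _).1 hh |>.length_le
    omega
  rw [sent, transmit, if_neg hu, Protocol.emit, hnone, Option.isSome_none, if_neg (by simp)]
  change (plan ω.1).message N _ _ (List.length _) _ = _
  rw [hlen]
  exact message_congr (fun r' hr' => viewOf_history _ _ _ _ _ hr') _ _

lemma isRun : (plan ω.1).IsRun G (inboxes (Plan.protocol plan n N) G ω b) where
  auth v r q x hx := by
    obtain ⟨y, -, rfl⟩ := Option.map_eq_some_iff.1 hx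
    rfl
  correct u hu v r hr := by
    rw [inboxes, Equiv.apply_symm_apply, sent_eq plan G ω b hr hu]

lemma decided_eq (v : Fin n) :
    decided (Plan.protocol plan n N) G ω b ((plan ω.1).lastRound + 1) v =
      some ((plan ω.1).newName (inboxes (Plan.protocol plan n N) G ω b v)) := by
  set h := history (Plan.protocol plan n N) G ω b ((plan ω.1).lastRound + 1) v with hh
  have hlen : h.length = (plan ω.1).lastRound + 1 := by simp [hh, history_eq]
  have hname : (plan ω.1).newName (viewOf h) =
      (plan ω.1).newName (inboxes (Plan.protocol plan n N) G ω b v) := by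
    have h0 : viewOf h 0 = inboxes (Plan.protocol plan n N) G ω b v 0 :=
      viewOf_history _ _ _ _ _ (by omega)
    have h1 : viewOf h (plan ω.1).lastRound =
        inboxes (Plan.protocol plan n N) G ω b v (plan ω.1).lastRound :=
      viewOf_history _ _ _ _ _ (by omega)
    simp only [newName, announcements, hubPort_congr (p := plan ω.1) h0, h1]
  have hout : (Plan.protocol plan n N).output ω.1 (ω.2 v) (G.ident v) h =
      some ((plan ω.1).newName (viewOf h)) := if_pos hlen
  rw [← hname]
  change h.inits.findSome? _ = _
  cases hf : h.inits.findSome? ((Plan.protocol plan n N).output ω.1 (ω.2 v) (G.ident v)) with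
  | none =>
    have := List.findSome?_eq_none_iff.1 hf h ((List.mem_inits _ _).2 (List.prefix_refl h))
    rw [hout] at this
    exact absurd this (by simp)
  | some a =>
    obtain ⟨h', hmem, ha⟩ := List.exists_of_findSome?_eq_some hf
    have hpre := (List.mem_inits _ _).1 hmem
    have hlen' : h'.length = (plan ω.1).lastRound + 1 := by
      by_contra hne
      have : (Plan.protocol plan n N).output ω.1 (ω.2 v) (G.ident v) h' = none := if_neg hne
      rw [this] at ha
      exact absurd ha (by simp)
    rw [hpre.eq_of_length (by omega), hout] at ha
    exact ha.symm

lemma messageCount_le (hG : (plan ω.1).Good G) :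
    messageCount (Plan.protocol plan n N) G ω b ((plan ω.1).lastRound + 1) ≤
      ((plan ω.1).lastRound + 1) * (2 * (n * (plan ω.1).slots)) := by
  set p := plan ω.1 with hp
  have hround : ∀ r ∈ Finset.range (p.lastRound + 1), ∑ u ∈ G.byzᶜ, (Finset.univ.filter fun v =>
      (sent (Plan.protocol plan n N) G ω b r u v).isSome = true).card ≤ 2 * (n * p.slots) := by
    intro r hr
    rw [Finset.mem_range] at hr
    have hu : ∀ u ∈ G.byzᶜ, (Finset.univ.filter fun v =>
        (sent (Plan.protocol plan n N) G ω b r u v).isSome = true).card ≤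
        (if p.bucket (G.ident u) = 0 then n else 0) + p.slots := by
      intro u hu
      rw [Finset.mem_compl] at hu
      split_ifs with hb
      · exact (Finset.card_le_univ _).trans (by simp)
      · rw [zero_add]
        refine le_trans (Finset.card_le_card fun v hv => ?_) (hG.small 0)
        simp only [Finset.mem_filter, Finset.mem_univ, true_and] at hv ⊢
        rw [sent_eq plan G ω b (Nat.lt_succ_iff.1 hr) hu, Option.isSome_iff_exists] at hv
        obtain ⟨x, hx⟩ := hv
        exact (isRun plan G ω b).hubPort_bucket ((hub_of_message hx).resolve_left hb)
    calc _ ≤ ∑ u ∈ G.byzᶜ, ((if p.bucket (G.ident u) = 0 then n else 0) + p.slots) :=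
          Finset.sum_le_sum hu
      _ ≤ ∑ u, ((if p.bucket (G.ident u) = 0 then n else 0) + p.slots) :=
          Finset.sum_le_sum_of_subset (Finset.subset_univ _)
      _ = (Finset.univ.filter fun u => p.bucket (G.ident u) = 0).card * n + n * p.slots := by
          rw [Finset.sum_add_distrib, ← Finset.sum_filter]
          simp
      _ ≤ p.slots * n + n * p.slots := by gcongr; exact hG.small 0
      _ = _ := by ring
  calc _ ≤ ∑ _r ∈ Finset.range (p.lastRound + 1), 2 * (n * p.slots) := Finset.sum_le_sum hround
    _ = _ := by simp

/-- Under a good plan the protocol succeeds, whatever the Byzantine nodes do. -/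
lemma succeeds (hG : (plan ω.1).Good G) {T M : ℝ}
    (hT : (((plan ω.1).lastRound + 1 : ℕ) : ℝ) ≤ T)
    (hM : ((((plan ω.1).lastRound + 1) * (2 * (n * (plan ω.1).slots)) : ℕ) : ℝ) ≤ M) :
    Succeeds (Plan.protocol plan n N) G ω b T M :=
  ⟨_, hT, ⟨_, fun v _ => decided_eq plan G ω b v,
    isStrongOrderPreserving_newName (isRun plan G ω b) hG⟩,
    (Nat.cast_le.2 (messageCount_le plan G ω b hG)).trans hM⟩

end Plan

end ByzRenaming

/-! ### Random functions: concentration of bucket sizes, and unique kings -/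

namespace ByzRenaming

open scoped Classical

section Counting

variable {α I κ : Type} [Fintype I] [DecidableEq I] [Fintype κ]
  [DecidableEq κ]

/-- The moment generating function of the number of elements of `A` that a uniformly random
function on `I ⊇ A` puts into bucket `B`. -/
lemma sum_exp_card (e : α ↪ I) (A : Finset α) (B : κ) (l : ℝ) :
    ∑ F : I → κ, Real.exp (l * (A.filter fun u => F (e u) = B).card) =
      (Fintype.card κ : ℝ) ^ Fintype.card I *
        (1 + (Real.exp l - 1) / Fintype.card κ) ^ A.card := by
  have hκ : (Fintype.card κ : ℝ) ≠ 0 := by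
    have : 0 < Fintype.card κ := Fintype.card_pos_iff.2 ⟨B⟩
    positivity
  have h1 : ∀ F : I → κ, Real.exp (l * (A.filter fun u => F (e u) = B).card) =
      ∏ i, if i ∈ A.map e ∧ F i = B then Real.exp l else 1 := by
    intro F
    have hc : (A.filter fun u => F (e u) = B).map e =
        Finset.univ.filter fun i => i ∈ A.map e ∧ F i = B := by
      ext i
      simp only [Finset.mem_map, Finset.mem_filter, Finset.mem_univ, true_and]
      constructor
      · rintro ⟨u, ⟨hu, hF⟩, rfl⟩
        exact ⟨⟨u, hu, rfl⟩, hF⟩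
      · rintro ⟨⟨u, hu, rfl⟩, hF⟩
        exact ⟨u, ⟨hu, hF⟩, rfl⟩
    rw [Finset.prod_ite, Finset.prod_const_one, mul_one, Finset.prod_const, ← Real.exp_nat_mul,
      mul_comm, ← hc, Finset.card_map]
  have h2 : ∀ i, (∑ x : κ, if i ∈ A.map e ∧ x = B then Real.exp l else 1) =
      Fintype.card κ * if i ∈ A.map e then 1 + (Real.exp l - 1) / Fintype.card κ else 1 := by
    intro i
    split_ifs with hi
    · have : ∀ x : κ, (if i ∈ A.map e ∧ x = B then Real.exp l else 1) =
          1 + if x = B then Real.exp l - 1 else 0 := by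
        intro x
        by_cases hx : x = B <;> simp [hi, hx]
      simp only [this, Finset.sum_add_distrib, Finset.sum_ite_eq', Finset.mem_univ, if_true]
      simp only [Finset.sum_const, Finset.card_univ, nsmul_eq_mul, mul_one]
      field_simp
    · simp [hi]
  simp only [h1]
  have h3 := Finset.prod_univ_sum (fun _ : I => (Finset.univ : Finset κ))
    (fun i x => if i ∈ A.map e ∧ x = B then Real.exp l else (1 : ℝ))
  rw [Fintype.piFinset_univ] at h3
  rw [← h3]
  simp only [h2]
  rw [Finset.prod_mul_distrib, Finset.prod_const, Finset.prod_ite, Finset.prod_const_one, mul_one,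
    Finset.prod_const, Finset.card_univ]
  congr 2
  rw [← Finset.card_map e]
  congr 1
  ext i
  simp

/-- A Chernoff bound: the sign of `l` decides between the upper and the lower tail. -/
lemma card_deviation_le (e : α ↪ I) (A : Finset α) (B : κ) {l ν : ℝ} (hl : |l| ≤ 1)
    (hν : (A.card : ℝ) / Fintype.card κ ≤ ν) :
    ((Finset.univ.filter fun F : I → κ => 2 * l ^ 2 * ν ≤
      l * ((A.filter fun u => F (e u) = B).card - (A.card : ℝ) / Fintype.card κ)).card : ℝ) ≤
      Real.exp (-(l ^ 2 * ν)) * (Fintype.card κ : ℝ) ^ Fintype.card I := by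
  set q : ℝ := (Fintype.card κ : ℝ) with hq
  set a : ℝ := (A.card : ℝ) / q with ha
  have hqpos : 1 ≤ q := by
    have : 0 < Fintype.card κ := Fintype.card_pos_iff.2 ⟨B⟩
    rw [hq]
    exact_mod_cast this
  have ha0 : 0 ≤ a := by positivity
  have hexp : Real.exp l - 1 ≤ l + l ^ 2 := by
    have := abs_le.1 (Real.abs_exp_sub_one_sub_id_le hl)
    linarith [this.2]
  have hbase : 0 ≤ 1 + (Real.exp l - 1) / q := by
    have h1 : -1 ≤ (Real.exp l - 1) / q := by
      rw [le_div_iff₀ (by linarith)]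
      nlinarith [Real.exp_pos l]
    linarith
  have hmgf : (1 + (Real.exp l - 1) / q) ^ A.card ≤ Real.exp (a * (l + l ^ 2)) := by
    calc (1 + (Real.exp l - 1) / q) ^ A.card
        ≤ Real.exp ((Real.exp l - 1) / q) ^ A.card := by
          refine pow_le_pow_left₀ hbase ?_ _
          linarith [Real.add_one_le_exp ((Real.exp l - 1) / q)]
      _ = Real.exp (a * (Real.exp l - 1)) := by
          rw [← Real.exp_nat_mul, ha]
          congr 1
          ring
      _ ≤ _ := Real.exp_le_exp.2 (mul_le_mul_of_nonneg_left hexp ha0)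
  have hmarkov : ((Finset.univ.filter fun F : I → κ => 2 * l ^ 2 * ν ≤
      l * ((A.filter fun u => F (e u) = B).card - a)).card : ℝ) *
      Real.exp (2 * l ^ 2 * ν + l * a) ≤
      ∑ F : I → κ, Real.exp (l * (A.filter fun u => F (e u) = B).card) := by
    rw [← nsmul_eq_mul, ← Finset.sum_const]
    refine (Finset.sum_le_sum fun F hF => ?_).trans
      (Finset.sum_le_sum_of_subset_of_nonneg (Finset.subset_univ _)
        fun _ _ _ => (Real.exp_pos _).le)
    have := (Finset.mem_filter.1 hF).2
    exact Real.exp_le_exp.2 (by linarith)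
  rw [sum_exp_card] at hmarkov
  have hpos := Real.exp_pos (2 * l ^ 2 * ν + l * a)
  rw [← mul_le_mul_iff_left₀ hpos]
  refine hmarkov.trans ?_
  rw [mul_comm, mul_right_comm, ← Real.exp_add]
  refine mul_le_mul_of_nonneg_right (hmgf.trans (Real.exp_le_exp.2 ?_)) (by positivity)
  nlinarith [mul_le_mul_of_nonneg_right hν (sq_nonneg l)]

/-- Among all functions, the proportion of those that vanish at `u` and at no other element of `C` is
at least `1 / (2 * (k + 1))`. -/
lemma card_unique_zero_ge {k : ℕ} {C : Finset I} {u : I} (hu : u ∈ C)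
    (hk : 2 * C.card ≤ k + 1) :
    ((k : ℝ) + 1) ^ Fintype.card I ≤ 2 * (k + 1) *
      (Finset.univ.filter fun g : I → Fin (k + 1) => ∀ i ∈ C, g i = 0 ↔ i = u).card := by
  -- The functions in question form a product of sets of values.
  set t : I → Finset (Fin (k + 1)) := fun i =>
    if i = u then {0} else if i ∈ C then {0}ᶜ else Finset.univ with ht
  have hset : (Finset.univ.filter fun g : I → Fin (k + 1) => ∀ i ∈ C, g i = 0 ↔ i = u) =
      Fintype.piFinset t := by
    ext g
    simp only [Finset.mem_filter, Finset.mem_univ, true_and, Fintype.mem_piFinset, ht]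
    refine forall_congr' fun i => ?_
    by_cases hi : i = u
    · subst hi
      simp [hu]
    · by_cases hC : i ∈ C <;> simp [hi, hC]
  have hq : (0 : ℝ) < k + 1 := by positivity
  have hcard : ∀ i, ((t i).card : ℝ) = (k + 1) *
      ((if i = u then 1 / ((k : ℝ) + 1) else 1) *
        if i ∈ C.erase u then 1 - 1 / ((k : ℝ) + 1) else 1) := by
    intro i
    by_cases hi : i = u
    · subst hi
      simp [ht]
      field_simp
    · by_cases hC : i ∈ C
      · simp [ht, hi, hC, Finset.card_compl]
        field_simp
        ring
      · simp [ht, hi, hC]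
  rw [hset, Fintype.card_piFinset, Nat.cast_prod]
  simp only [hcard]
  rw [Finset.prod_mul_distrib, Finset.prod_mul_distrib, Finset.prod_const, Finset.card_univ,
    Finset.prod_ite_eq' Finset.univ u, if_pos (Finset.mem_univ u), Finset.prod_ite,
    Finset.prod_const_one, mul_one, Finset.prod_const, Finset.filter_mem_eq_inter,
    Finset.univ_inter, Finset.card_erase_of_mem hu]
  have hC1 : 1 ≤ C.card := Finset.card_pos.2 ⟨u, hu⟩
  have hbern : (1 / 2 : ℝ) ≤ (1 - 1 / ((k : ℝ) + 1)) ^ (C.card - 1) := by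
    have h1 := one_add_mul_le_pow (a := -(1 / ((k : ℝ) + 1))) (by
      have : 1 / ((k : ℝ) + 1) ≤ 1 := by
        rw [div_le_one hq]
        linarith [(Nat.cast_nonneg k : (0 : ℝ) ≤ k)]
      linarith) (C.card - 1)
    rw [← sub_eq_add_neg] at h1
    refine le_trans ?_ h1
    have h2 : ((C.card - 1 : ℕ) : ℝ) * (1 / ((k : ℝ) + 1)) ≤ 1 / 2 := by
      rw [mul_one_div, div_le_iff₀ hq]
      have : (2 * (C.card - 1 : ℕ) : ℝ) ≤ k + 1 := by
        exact_mod_cast (by omega : 2 * (C.card - 1) ≤ k + 1)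
      linarith
    linarith
  have hpow : (0 : ℝ) ≤ ((k : ℝ) + 1) ^ Fintype.card I := by positivity
  calc ((k : ℝ) + 1) ^ Fintype.card I = 2 * ((k : ℝ) + 1) ^ Fintype.card I * (1 / 2) := by ring
    _ ≤ 2 * ((k : ℝ) + 1) ^ Fintype.card I *
        (1 - 1 / ((k : ℝ) + 1)) ^ (C.card - 1) := by gcongr
    _ = _ := by field_simp

/-- A random function to `k + 1` values vanishes at exactly one element of `C`, and this one is in
`H`, with probability at least `1 / 24`, if `H` is a sufficiently large part of `C` and `k + 1` is
comparable to the size of `C`. -/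
lemma card_no_unique_zero_le {k : ℕ} {C H : Finset I} (hH : H ⊆ C) (hk : 2 * C.card ≤ k + 1)
    (hHk : k + 1 ≤ 12 * H.card) :
    ((Finset.univ.filter fun g : I → Fin (k + 1) =>
      ¬ ∃ u ∈ H, ∀ i ∈ C, g i = 0 ↔ i = u).card : ℝ) ≤
      23 / 24 * ((k : ℝ) + 1) ^ Fintype.card I := by
  have hdisj : (H : Set I).PairwiseDisjoint fun u =>
      Finset.univ.filter fun g : I → Fin (k + 1) => ∀ i ∈ C, g i = 0 ↔ i = u := by
    intro u hu w hw huw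
    refine Finset.disjoint_left.2 fun g hg hg' => huw ?_
    rw [Finset.mem_filter] at hg hg'
    exact (hg'.2 u (hH hu)).1 ((hg.2 u (hH hu)).2 rfl)
  have hunion : (Finset.univ.filter fun g : I → Fin (k + 1) =>
      ∃ u ∈ H, ∀ i ∈ C, g i = 0 ↔ i = u) = H.biUnion fun u =>
      Finset.univ.filter fun g : I → Fin (k + 1) => ∀ i ∈ C, g i = 0 ↔ i = u := by
    ext g
    simp
  have hsum := Finset.card_biUnion hdisj
  rw [← hunion] at hsum
  have htot := Finset.card_filter_add_card_filter_not (s := (Finset.univ : Finset (I → Fin (k + 1))))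
    (fun g => ∃ u ∈ H, ∀ i ∈ C, g i = 0 ↔ i = u)
  rw [Finset.card_univ, Fintype.card_fun, Fintype.card_fin] at htot
  have htot' : ((Finset.univ.filter fun g : I → Fin (k + 1) =>
      ∃ u ∈ H, ∀ i ∈ C, g i = 0 ↔ i = u).card : ℝ) + (Finset.univ.filter
      fun g : I → Fin (k + 1) => ¬ ∃ u ∈ H, ∀ i ∈ C, g i = 0 ↔ i = u).card =
      ((k : ℝ) + 1) ^ Fintype.card I := by exact_mod_cast htot
  have hq : (0 : ℝ) < k + 1 := by positivity
  have hlow : (H.card : ℝ) * (((k : ℝ) + 1) ^ Fintype.card I / (2 * (k + 1))) ≤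
      ((Finset.univ.filter fun g : I → Fin (k + 1) =>
        ∃ u ∈ H, ∀ i ∈ C, g i = 0 ↔ i = u).card : ℝ) := by
    rw [hsum, Nat.cast_sum, ← nsmul_eq_mul, ← Finset.sum_const]
    refine Finset.sum_le_sum fun u hu => ?_
    rw [div_le_iff₀ (by positivity), mul_comm]
    exact card_unique_zero_ge (hH hu) hk
  have hHk' : (k : ℝ) + 1 ≤ 12 * H.card := by exact_mod_cast hHk
  have hfrac : 1 / 24 * ((k : ℝ) + 1) ^ Fintype.card I ≤
      (H.card : ℝ) * (((k : ℝ) + 1) ^ Fintype.card I / (2 * (k + 1))) := by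
    rw [← mul_div_assoc, le_div_iff₀ (by positivity)]
    have := mul_le_mul_of_nonneg_right hHk' (by positivity :
      (0 : ℝ) ≤ ((k : ℝ) + 1) ^ Fintype.card I)
    linarith
  linarith

end Counting

end ByzRenaming

/-! ### A random plan is good -/

namespace ByzRenaming

open scoped Classical

section RandomPlan

variable {n N m k M D b : ℕ}

/-- The shared random strings: a random bucket for each possible identity, and for each of the `M`
phases a random value for each possible identity, which makes it a king if it is `0`. -/
abbrev Seed (N m k M : ℕ) : Type :=
  (Fin (N + 1) → Fin (m + 1)) × (Fin M → Fin (N + 1) → Fin (k + 1))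

/-- The plan that a shared random string determines. -/
def randomPlan (D b : ℕ) (s : Seed N m k M) : Plan m where
  bucket i := s.1 (Fin.ofNat (N + 1) i)
  king j i := ∃ h : j < M, s.2 ⟨j, h⟩ (Fin.ofNat (N + 1) i) = 0
  phases := M
  slots := D
  bound := b

/-- The identity of a node as an argument of the random functions. -/
def identEmb (G : Network n N) : Fin n ↪ Fin (N + 1) where
  toFun u := Fin.ofNat (N + 1) (G.ident u)
  inj' u v h := by
    have h' := congrArg Fin.val h
    rw [Fin.val_ofNat, Fin.val_ofNat, Nat.mod_eq_of_lt (Nat.lt_succ_of_le (G.ident_mem u).2),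
      Nat.mod_eq_of_lt (Nat.lt_succ_of_le (G.ident_mem v).2)] at h'
    exact G.ident_injective h'

/-- The nodes of `A` in bucket `B`. -/
noncomputable def bucketOf (G : Network n N) (F : Fin (N + 1) → Fin (m + 1)) (A : Finset (Fin n))
    (B : Fin (m + 1)) : Finset (Fin n) :=
  A.filter fun u => F (identEmb G u) = B

/-- The conditions on the distribution over buckets in `Plan.Good`. -/
def Balanced (D b : ℕ) (G : Network n N) (F : Fin (N + 1) → Fin (m + 1)) : Prop :=
  ∀ B, 2 * b < (bucketOf G F G.byzᶜ B).card ∧ (bucketOf G F G.byz B).card ≤ b ∧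
    (bucketOf G F Finset.univ B).card ≤ D

/-- Exactly one hub is king for the random values `g`, and it is correct. -/
def KingGood (G : Network n N) (F : Fin (N + 1) → Fin (m + 1)) (g : Fin (N + 1) → Fin (k + 1)) :
    Prop :=
  ∃ i ∈ (bucketOf G F G.byzᶜ 0).map (identEmb G),
    ∀ i' ∈ (bucketOf G F Finset.univ 0).map (identEmb G), g i' = 0 ↔ i' = i

lemma good_randomPlan {G : Network n N} {s : Seed N m k M} (h : Balanced D b G s.1)
    (hk : ∃ j, KingGood G s.1 (s.2 j)) : (randomPlan D b s).Good G where
  many_correct B := by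
    refine (h B).1.trans_le (Finset.card_le_card fun u hu => ?_)
    obtain ⟨hu1, hu2⟩ := Finset.mem_filter.1 hu
    exact Finset.mem_filter.2 ⟨Finset.mem_univ _, Finset.mem_compl.1 hu1, hu2⟩
  few_byz B := by
    refine (Finset.card_le_card fun u hu => ?_).trans (h B).2.1
    obtain ⟨-, hu1, hu2⟩ := Finset.mem_filter.1 hu
    exact Finset.mem_filter.2 ⟨hu1, hu2⟩
  small B := by
    refine (Finset.card_le_card fun u hu => ?_).trans (h B).2.2
    exact Finset.mem_filter.2 ⟨Finset.mem_univ _, (Finset.mem_filter.1 hu).2⟩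
  king := by
    obtain ⟨j, i, hi, huniq⟩ := hk
    obtain ⟨κ, hκ, rfl⟩ := Finset.mem_map.1 hi
    obtain ⟨hκ1, hκ2⟩ := Finset.mem_filter.1 hκ
    refine ⟨j, j.2, κ, Finset.mem_compl.1 hκ1, hκ2, ⟨j.2, ?_⟩, ?_⟩
    · exact (huniq _ (Finset.mem_map_of_mem _
        (Finset.mem_filter.2 ⟨Finset.mem_univ _, hκ2⟩))).2 rfl
    · rintro u hu ⟨_, hu0⟩
      exact (identEmb G).injective ((huniq _ (Finset.mem_map_of_mem _
        (Finset.mem_filter.2 ⟨Finset.mem_univ _, hu⟩))).1 hu0)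

/-- By the Chernoff bound and a union bound over the buckets, a random distribution over buckets
is balanced if the mean bucket size `n / (m + 1)` is large; for a single bucket it always is. -/
lemma card_not_balanced_le {δ ε : ℝ} (hδ : 0 < δ) (hn : 1 ≤ n) {G : Network n N}
    (hf : (G.byz.card : ℝ) < (1 / 3 - δ) * n)
    (hb1 : (b : ℝ) ≤ (n : ℝ) / (m + 1) / 3) (hb2 : (n : ℝ) / (m + 1) / 3 < b + 1)
    (hD : 2 * ((n : ℝ) / (m + 1)) < D + 1) (hε0 : 0 ≤ ε)
    (hε : m = 0 ∨ 3 * (m + 1) * Real.exp (-((δ / 2) ^ 2 * ((n : ℝ) / (m + 1)))) ≤ ε) :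
    ((Finset.univ.filter fun F : Fin (N + 1) → Fin (m + 1) => ¬ Balanced D b G F).card : ℝ) ≤
      ε * ((m : ℝ) + 1) ^ (N + 1) := by
  have hn' : (0 : ℝ) < n := by exact_mod_cast hn
  have hcompl : ((G.byzᶜ).card : ℝ) = n - G.byz.card := by
    rw [Finset.card_compl, Nat.cast_sub (Finset.card_le_univ _), Fintype.card_fin]
  have hδ1 : δ < 1 / 3 := by
    have := (Nat.cast_nonneg G.byz.card : (0 : ℝ) ≤ G.byz.card).trans_lt hf
    have := pos_of_mul_pos_left this hn'.le
    linarith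
  rcases hε with rfl | hε
  · have hall : ∀ F : Fin (N + 1) → Fin (0 + 1), Balanced D b G F := by
      intro F B
      have hB : ∀ A, bucketOf G F A B = A := fun A =>
        Finset.filter_true_of_mem fun u _ => Fin.ext (by omega)
      rw [hB, hB, hB, Finset.card_univ, Fintype.card_fin]
      norm_num at hb1 hb2 hD
      refine ⟨?_, ?_, ?_⟩
      · have : ((2 * b : ℕ) : ℝ) < (G.byzᶜ).card := by
          push_cast
          rw [hcompl]
          nlinarith
        exact_mod_cast this
      · have : (G.byz.card : ℝ) < ((b + 1 : ℕ) : ℝ) := by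
          push_cast
          nlinarith
        exact Nat.lt_succ_iff.1 (by exact_mod_cast this)
      · have : (n : ℝ) < ((D + 1 : ℕ) : ℝ) := by
          push_cast
          linarith
        exact Nat.lt_succ_iff.1 (by exact_mod_cast this)
    rw [Finset.filter_false_of_mem fun F _ => not_not.2 (hall F)]
    simp only [Finset.card_empty, Nat.cast_zero]
    positivity
  set q : ℝ := (m : ℝ) + 1 with hq
  set ν : ℝ := n / q with hν
  have hq0 : 0 < q := by positivity
  have hν0 : 0 < ν := by positivity
  -- The means leave a margin of `δ * ν`, and `l = ± δ / 2` satisfies `2 * l ^ 2 * ν = |l| * (δ * ν)`.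
  let dev : Finset (Fin n) → ℝ → Fin (m + 1) → Finset (Fin (N + 1) → Fin (m + 1)) := fun A l B =>
    Finset.univ.filter fun F => 2 * l ^ 2 * ν ≤
      l * ((A.filter fun u => F (identEmb G u) = B).card - (A.card : ℝ) / q)
  have hdev : ∀ A l B, |l| = δ / 2 → ((dev A l B).card : ℝ) ≤
      Real.exp (-((δ / 2) ^ 2 * ν)) * q ^ (N + 1) := by
    intro A l B hl
    have hcard : (Fintype.card (Fin (m + 1)) : ℝ) = q := by simp [hq]
    have := card_deviation_le (identEmb G) A B (l := l) (ν := ν) (by linarith) (by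
      rw [hcard]
      have : (A.card : ℝ) ≤ n := by exact_mod_cast (Finset.card_le_univ A).trans (by simp)
      exact div_le_div_of_nonneg_right this hq0.le)
    rw [hcard, Fintype.card_fin] at this
    exact this.trans_eq (by rw [← sq_abs l, hl])
  have hsub : (Finset.univ.filter fun F : Fin (N + 1) → Fin (m + 1) => ¬ Balanced D b G F) ⊆
      Finset.univ.biUnion fun B =>
        dev G.byzᶜ (-(δ / 2)) B ∪ (dev G.byz (δ / 2) B ∪ dev Finset.univ (δ / 2) B) := by
    intro F hF
    have hF := (Finset.mem_filter.1 hF).2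
    simp only [Balanced, not_forall] at hF
    obtain ⟨B, hB⟩ := hF
    refine Finset.mem_biUnion.2 ⟨B, Finset.mem_univ _, ?_⟩
    simp only [Finset.mem_union, dev, Finset.mem_filter, Finset.mem_univ, true_and]
    by_contra hno
    push Not at hno
    obtain ⟨h1, h2, h3⟩ := hno
    refine hB ⟨?_, ?_, ?_⟩
    · by_contra hle
      have hle : ((bucketOf G F G.byzᶜ B).card : ℝ) ≤ 2 * b := by exact_mod_cast not_lt.1 hle
      have hmean : (2 / 3 + δ) * ν ≤ ((G.byzᶜ).card : ℝ) / q := by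
        rw [hν, ← mul_div_assoc]
        gcongr
        rw [hcompl]
        linarith
      have hx : ((bucketOf G F G.byzᶜ B).card : ℝ) - ((G.byzᶜ).card : ℝ) / q ≤ -(δ * ν) := by
        linarith
      change -(δ / 2) * (((bucketOf G F G.byzᶜ B).card : ℝ) - ((G.byzᶜ).card : ℝ) / q) < _ at h1
      linarith [mul_le_mul_of_nonneg_left hx (half_pos hδ).le]
    · by_contra hlt
      have hlt : (b : ℝ) + 1 ≤ (bucketOf G F G.byz B).card := by exact_mod_cast not_le.1 hlt
      have hmean : (G.byz.card : ℝ) / q ≤ (1 / 3 - δ) * ν := by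
        rw [hν, ← mul_div_assoc]
        gcongr
      have hx : δ * ν ≤ ((bucketOf G F G.byz B).card : ℝ) - (G.byz.card : ℝ) / q := by
        linarith
      change δ / 2 * (((bucketOf G F G.byz B).card : ℝ) - (G.byz.card : ℝ) / q) < _ at h2
      linarith [mul_le_mul_of_nonneg_left hx (half_pos hδ).le]
    · by_contra hlt
      have hlt : (D : ℝ) + 1 ≤ (bucketOf G F Finset.univ B).card := by
        exact_mod_cast not_le.1 hlt
      have hx : δ * ν ≤ ((bucketOf G F Finset.univ B).card : ℝ) - (n : ℝ) / q := by
        rw [← hν]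
        nlinarith
      rw [Finset.card_univ, Fintype.card_fin] at h3
      change δ / 2 * (((bucketOf G F Finset.univ B).card : ℝ) - (n : ℝ) / q) < _ at h3
      linarith [mul_le_mul_of_nonneg_left hx (half_pos hδ).le]
  have habs : |δ / 2| = δ / 2 := abs_of_pos (by linarith)
  have habs' : |-(δ / 2)| = δ / 2 := by rw [abs_neg, habs]
  calc ((Finset.univ.filter fun F : Fin (N + 1) → Fin (m + 1) => ¬ Balanced D b G F).card : ℝ)
      ≤ ∑ B, ((dev G.byzᶜ (-(δ / 2)) B ∪
          (dev G.byz (δ / 2) B ∪ dev Finset.univ (δ / 2) B)).card : ℝ) := by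
        exact_mod_cast (Finset.card_le_card hsub).trans Finset.card_biUnion_le
    _ ≤ ∑ _B : Fin (m + 1), 3 * (Real.exp (-((δ / 2) ^ 2 * ν)) * q ^ (N + 1)) := by
        refine Finset.sum_le_sum fun B _ => ?_
        have h1 := hdev G.byzᶜ (-(δ / 2)) B habs'
        have h2 := hdev G.byz (δ / 2) B habs
        have h3 := hdev Finset.univ (δ / 2) B habs
        have h4 : ((dev G.byzᶜ (-(δ / 2)) B ∪
            (dev G.byz (δ / 2) B ∪ dev Finset.univ (δ / 2) B)).card : ℝ) ≤
            (dev G.byzᶜ (-(δ / 2)) B).card +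
              ((dev G.byz (δ / 2) B).card + (dev Finset.univ (δ / 2) B).card) := by
          exact_mod_cast (Finset.card_union_le _ _).trans
            (Nat.add_le_add_left (Finset.card_union_le _ _) _)
        linarith
    _ = 3 * q * Real.exp (-((δ / 2) ^ 2 * ν)) * q ^ (N + 1) := by
        rw [Finset.sum_const, Finset.card_univ, Fintype.card_fin, nsmul_eq_mul, hq]
        push_cast
        ring
    _ ≤ ε * q ^ (N + 1) := by gcongr

/-- If the distribution over buckets is balanced, it is unlikely that all phases lack a good
king. -/
lemma card_no_king_le {G : Network n N} {F : Fin (N + 1) → Fin (m + 1)} (hF : Balanced D b G F)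
    (hk : k + 1 = 2 * D) (hD : D ≤ 6 * (2 * b + 1)) :
    ((Finset.univ.filter fun g : Fin M → Fin (N + 1) → Fin (k + 1) =>
      ∀ j, ¬ KingGood G F (g j)).card : ℝ) ≤ (23 / 24 * ((k : ℝ) + 1) ^ (N + 1)) ^ M := by
  have hset : (Finset.univ.filter fun g : Fin M → Fin (N + 1) → Fin (k + 1) =>
      ∀ j, ¬ KingGood G F (g j)) = Fintype.piFinset fun _ =>
        Finset.univ.filter fun g : Fin (N + 1) → Fin (k + 1) => ¬ KingGood G F g := by
    ext g
    simp [Fintype.mem_piFinset]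
  rw [hset, Fintype.card_piFinset, Finset.prod_const, Finset.card_univ, Fintype.card_fin,
    Nat.cast_pow]
  refine pow_le_pow_left₀ (Nat.cast_nonneg _) ?_ _
  have := card_no_unique_zero_le (k := k)
    (C := (bucketOf G F Finset.univ 0).map (identEmb G))
    (H := (bucketOf G F G.byzᶜ 0).map (identEmb G))
    (Finset.map_subset_map.2 (Finset.filter_subset_filter _ (Finset.subset_univ _)))
    (by rw [Finset.card_map]; have := (hF 0).2.2; omega)
    (by rw [Finset.card_map]; have := (hF 0).1; omega)
  rw [Fintype.card_fin] at this
  refine le_trans (Nat.cast_le.2 (Finset.card_le_card ?_)) this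
  intro g hg
  simp only [Finset.mem_filter, Finset.mem_univ, true_and] at hg ⊢
  exact hg

lemma card_not_good_le {G : Network n N} {ε ε' : ℝ}
    (hF : ((Finset.univ.filter fun F : Fin (N + 1) → Fin (m + 1) =>
      ¬ Balanced D b G F).card : ℝ) ≤ ε * ((m : ℝ) + 1) ^ (N + 1))
    (hk : k + 1 = 2 * D) (hD : D ≤ 6 * (2 * b + 1)) (hε' : (23 / 24 : ℝ) ^ M ≤ ε') :
    ((Finset.univ.filter fun s : Seed N m k M => ¬ (randomPlan D b s).Good G).card : ℝ) ≤
      (ε + ε') * Fintype.card (Seed N m k M) := by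
  set T : ℝ := (((k : ℝ) + 1) ^ (N + 1)) ^ M with hT
  have hT0 : 0 ≤ T := by positivity
  have hcard : (Fintype.card (Seed N m k M) : ℝ) = ((m : ℝ) + 1) ^ (N + 1) * T := by
    simp [Seed, hT]
  have hcardT : (Fintype.card (Fin M → Fin (N + 1) → Fin (k + 1)) : ℝ) = T := by
    simp [hT]
  have hterm : ∀ F : Fin (N + 1) → Fin (m + 1), ((Finset.univ.filter
      fun g : Fin M → Fin (N + 1) → Fin (k + 1) =>
        ¬ (randomPlan D b ((F, g) : Seed N m k M)).Good G).card : ℝ) ≤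
      (if ¬ Balanced D b G F then T else 0) + ε' * T := by
    intro F
    split_ifs with hbal
    · rw [zero_add]
      calc _ ≤ ((Finset.univ.filter fun g : Fin M → Fin (N + 1) → Fin (k + 1) =>
            ∀ j, ¬ KingGood G F (g j)).card : ℝ) := by
            refine Nat.cast_le.2 (Finset.card_le_card fun g hg => ?_)
            refine Finset.mem_filter.2 ⟨Finset.mem_univ _, ?_⟩
            by_contra hno
            push Not at hno
            exact (Finset.mem_filter.1 hg).2 (good_randomPlan hbal hno)
        _ ≤ (23 / 24 * ((k : ℝ) + 1) ^ (N + 1)) ^ M := card_no_king_le hbal hk hD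
        _ = (23 / 24 : ℝ) ^ M * T := mul_pow _ _ _
        _ ≤ ε' * T := by gcongr
    · have h1 : ((Finset.univ.filter fun g : Fin M → Fin (N + 1) → Fin (k + 1) =>
          ¬ (randomPlan D b ((F, g) : Seed N m k M)).Good G).card : ℝ) ≤ T := by
        rw [← hcardT]
        exact_mod_cast Finset.card_le_univ _
      have h2 : 0 ≤ ε' * T := mul_nonneg ((by positivity : (0 : ℝ) ≤ (23 / 24) ^ M).trans hε') hT0
      linarith
  have hsplit : ((Finset.univ.filter fun s : Seed N m k M =>
      ¬ (randomPlan D b s).Good G).card : ℝ) = ∑ F : Fin (N + 1) → Fin (m + 1),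
        ((Finset.univ.filter fun g : Fin M → Fin (N + 1) → Fin (k + 1) =>
          ¬ (randomPlan D b ((F, g) : Seed N m k M)).Good G).card : ℝ) := by
    simp only [Finset.card_filter, Nat.cast_sum]
    exact Fintype.sum_prod_type _
  rw [hsplit, hcard]
  refine (Finset.sum_le_sum fun F _ => hterm F).trans ?_
  rw [Finset.sum_add_distrib, ← Finset.sum_filter, Finset.sum_const, Finset.sum_const,
    Finset.card_univ, nsmul_eq_mul, nsmul_eq_mul]
  simp only [Fintype.card_fun, Fintype.card_fin, Nat.cast_pow, Nat.cast_add, Nat.cast_one]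
  nlinarith [mul_le_mul_of_nonneg_right hF hT0]

end RandomPlan

/-- The failure probability of the protocol is that of the plan not being good. -/
lemma Plan.le_prob {n N m : ℕ} {S : Type} [Fintype S] [Nonempty S] (plan : S → Plan m)
    {E : Set (Plan.protocol plan n N).Coins} {Q : S → Prop} {ε : ℝ}
    (hQ : ∀ ω : (Plan.protocol plan n N).Coins, Q ω.1 → ω ∈ E)
    (hε : ((Finset.univ.filter fun s => ¬ Q s).card : ℝ) ≤ ε * Fintype.card S) :
    1 - ε ≤ (Plan.protocol plan n N).prob E := by
  let e : (Plan.protocol plan n N).Coins ≃ S :=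
    { toFun := Prod.fst
      invFun := fun s => (s, fun _ => ())
      left_inv := fun ω => rfl
      right_inv := fun s => rfl }
  have hfin : Finite (Plan.protocol plan n N).Coins := Finite.of_equiv S e.symm
  have hcard : Nat.card (Plan.protocol plan n N).Coins = Fintype.card S := by
    rw [Nat.card_congr e, Nat.card_eq_fintype_card]
  have hpos : (0 : ℝ) < Fintype.card S := by exact_mod_cast Fintype.card_pos
  have hcompl : Eᶜ.ncard ≤ (Finset.univ.filter fun s => ¬ Q s).card := by
    rw [← Set.ncard_coe_finset]
    refine Set.ncard_le_ncard_of_injOn e (fun ω hω => ?_) e.injective.injOn (Set.toFinite _)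
    exact Finset.mem_coe.2 (Finset.mem_filter.2 ⟨Finset.mem_univ _, fun h => hω (hQ ω h)⟩)
  have hadd := Set.ncard_add_ncard_compl E
  rw [hcard] at hadd
  have hadd' : (E.ncard : ℝ) + (Eᶜ.ncard : ℝ) = Fintype.card S := by exact_mod_cast hadd
  have hcompl' : (Eᶜ.ncard : ℝ) ≤ ε * Fintype.card S := (Nat.cast_le.2 hcompl).trans hε
  rw [Protocol.prob, hcard, le_div_iff₀ hpos]
  linarith

end ByzRenaming

/-! ### The choice of the parameters -/

namespace ByzRenaming

/-- The mean bucket size aimed at, slightly more than `c * log n`. -/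
noncomputable def bucketSize (c : ℝ) (n : ℕ) : ℕ := ⌈c * Real.log n⌉₊ + 1

/-- One less than the number of buckets, which is `n / bucketSize c n`, but at least `1`. -/
noncomputable def bucketsPred (c : ℝ) (n : ℕ) : ℕ := n / bucketSize c n - 1

/-- The number of slots: twice the mean bucket size. -/
noncomputable def slotNumber (c : ℝ) (n : ℕ) : ℕ := 2 * n / (bucketsPred c n + 1)

/-- The bound on the Byzantine nodes in a bucket: a third of the mean bucket size. -/
noncomputable def byzBound (c : ℝ) (n : ℕ) : ℕ := n / (3 * (bucketsPred c n + 1))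

/-- A number of phases that all lack a good king with probability at most `n ^ (-c)`. -/
noncomputable def phaseNumber (c : ℝ) (n : ℕ) : ℕ := ⌈24 * c * Real.log n⌉₊

lemma bucketsPred_add_one_le {c : ℝ} {n : ℕ} (hn : 1 ≤ n) : bucketsPred c n + 1 ≤ n := by
  unfold bucketsPred
  have := Nat.div_le_self n (bucketSize c n)
  omega

lemma lt_two_mul_bucketSize_mul (c : ℝ) (n : ℕ) :
    n < 2 * bucketSize c n * (bucketsPred c n + 1) := by
  have hL : 0 < bucketSize c n := Nat.succ_pos _
  have h1 := Nat.lt_mul_div_succ n hL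
  have h2 : n / bucketSize c n + 1 ≤ 2 * (bucketsPred c n + 1) := by
    unfold bucketsPred
    omega
  calc n < bucketSize c n * (n / bucketSize c n + 1) := h1
    _ ≤ bucketSize c n * (2 * (bucketsPred c n + 1)) := Nat.mul_le_mul_left _ h2
    _ = _ := by ring

lemma slotNumber_le (c : ℝ) (n : ℕ) : slotNumber c n ≤ 4 * bucketSize c n := by
  refine Nat.div_le_of_le_mul ?_
  have := lt_two_mul_bucketSize_mul c n
  linarith

lemma one_le_slotNumber {c : ℝ} {n : ℕ} (hn : 1 ≤ n) : 1 ≤ slotNumber c n := by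
  have := bucketsPred_add_one_le (c := c) hn
  exact (Nat.one_le_div_iff (Nat.succ_pos _)).2 (by omega)

/-- There is one bucket only, or the mean bucket size is at least `c * log n`. -/
lemma bucketsPred_eq_zero_or (c : ℝ) (n : ℕ) :
    bucketsPred c n = 0 ∨ c * Real.log n ≤ (n : ℝ) / ((bucketsPred c n : ℝ) + 1) := by
  rw [or_iff_not_imp_left]
  intro h
  have h1 : bucketsPred c n + 1 = n / bucketSize c n := by
    unfold bucketsPred at h ⊢
    omega
  have h2 : bucketSize c n * (bucketsPred c n + 1) ≤ n := by
    rw [h1]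
    exact Nat.mul_div_le n _
  have h3 : (bucketSize c n : ℝ) * ((bucketsPred c n : ℝ) + 1) ≤ n := by exact_mod_cast h2
  rw [le_div_iff₀ (by positivity)]
  refine le_trans (mul_le_mul_of_nonneg_right ?_ (by positivity)) h3
  rw [bucketSize]
  push_cast
  linarith [Nat.le_ceil (c * Real.log n)]

/-- The parameters are such that the plan is good with probability at least `1 - n ^ (-β)`. -/
lemma card_not_good_le_rpow {δ β : ℝ} (hδ : 0 < δ) {n N : ℕ} (hn : 2 ≤ n)
    {G : Network n N} (hf : (G.byz.card : ℝ) < (1 / 3 - δ) * n) {c : ℝ}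
    (hc : β + 4 ≤ (δ / 2) ^ 2 * c) {m k D b M : ℕ} (hm : m = bucketsPred c n)
    (hD : D = slotNumber c n) (hk : k = 2 * D - 1) (hb : b = byzBound c n)
    (hM : M = phaseNumber (β + 1) n) [DecidablePred fun s : Seed N m k M =>
      ¬ (randomPlan D b s).Good G] :
    ((Finset.univ.filter fun s : Seed N m k M => ¬ (randomPlan D b s).Good G).card : ℝ) ≤
      1 / (n : ℝ) ^ β * Fintype.card (Seed N m k M) := by
  classical
  have hn1 : 1 ≤ n := by omega
  have hnR : (2 : ℝ) ≤ n := by exact_mod_cast hn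
  have hn0 : (0 : ℝ) < n := by linarith
  have hlog : 0 < Real.log n := Real.log_pos (by linarith)
  have hmn : (m : ℝ) + 1 ≤ n := by
    rw [hm]
    exact_mod_cast bucketsPred_add_one_le hn1
  have hD1 : 1 ≤ D := hD ▸ one_le_slotNumber hn1
  have hq : (0 : ℝ) < (m : ℝ) + 1 := by positivity
  have hb1 : (b : ℝ) ≤ (n : ℝ) / (m + 1) / 3 := by
    rw [div_div, le_div_iff₀ (by positivity), hb, byzBound, ← hm]
    have := Nat.div_mul_le_self n (3 * (m + 1))
    have : ((n / (3 * (m + 1)) * (3 * (m + 1)) : ℕ) : ℝ) ≤ n := by exact_mod_cast this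
    push_cast at this ⊢
    linarith
  have hb2 : (n : ℝ) / (m + 1) / 3 < b + 1 := by
    rw [div_div, div_lt_iff₀ (by positivity), hb, byzBound, ← hm]
    have := Nat.lt_mul_div_succ n (show 0 < 3 * (m + 1) by omega)
    have : (n : ℝ) < ((3 * (m + 1) * (n / (3 * (m + 1)) + 1) : ℕ) : ℝ) := by exact_mod_cast this
    push_cast at this ⊢
    linarith
  have hDlt : 2 * ((n : ℝ) / (m + 1)) < D + 1 := by
    rw [← mul_div_assoc, div_lt_iff₀ hq, hD, slotNumber, ← hm]
    have := Nat.lt_mul_div_succ (2 * n) (show 0 < m + 1 by omega)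
    have : (2 * n : ℝ) < (((m + 1) * (2 * n / (m + 1) + 1) : ℕ) : ℝ) := by exact_mod_cast this
    push_cast at this ⊢
    linarith
  -- `D` is about six times `b`; the form `2 * b + 1` takes care of `b = 0`.
  have hDb : D ≤ 6 * (2 * b + 1) := by
    have h1 : D * (m + 1) ≤ 2 * n := by
      rw [hD, slotNumber, ← hm]
      exact Nat.div_mul_le_self _ _
    have h2 : n < 3 * (m + 1) * (b + 1) := by
      rw [hb, byzBound, ← hm]
      exact Nat.lt_mul_div_succ n (by omega)
    have h3 : D * (m + 1) < 6 * (b + 1) * (m + 1) := by linarith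
    have := Nat.lt_of_mul_lt_mul_right h3
    omega
  have hexp : ∀ x : ℝ, Real.exp (-(x * Real.log n)) = 1 / (n : ℝ) ^ x := fun x => by
    rw [Real.exp_neg, one_div, Real.rpow_def_of_pos hn0, mul_comm x]
  have hpow : (0 : ℝ) < (n : ℝ) ^ β := Real.rpow_pos_of_pos hn0 β
  have hε : m = 0 ∨ 3 * ((m : ℝ) + 1) * Real.exp (-((δ / 2) ^ 2 * ((n : ℝ) / (m + 1)))) ≤
      1 / 2 * (1 / (n : ℝ) ^ β) := by
    rcases bucketsPred_eq_zero_or c n with h | h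
    · exact Or.inl (hm.trans h)
    · rw [← hm] at h
      right
      have h1 : Real.exp (-((δ / 2) ^ 2 * ((n : ℝ) / (m + 1)))) ≤ 1 / (n : ℝ) ^ (β + 4) := by
        rw [← hexp]
        refine Real.exp_le_exp.2 (neg_le_neg ?_)
        calc (β + 4) * Real.log n ≤ (δ / 2) ^ 2 * c * Real.log n := by gcongr
          _ = (δ / 2) ^ 2 * (c * Real.log n) := by ring
          _ ≤ _ := by gcongr
      have h2 : (n : ℝ) ^ (β + 4) = (n : ℝ) ^ β * (n : ℝ) ^ 4 := by
        rw [Real.rpow_add hn0]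
        norm_cast
      have h3 : (8 : ℝ) * n ≤ (n : ℝ) ^ 4 := by
        have : (2 : ℝ) ^ 3 ≤ (n : ℝ) ^ 3 := by gcongr
        nlinarith
      calc 3 * ((m : ℝ) + 1) * Real.exp (-((δ / 2) ^ 2 * ((n : ℝ) / (m + 1))))
          ≤ 3 * n * (1 / (n : ℝ) ^ (β + 4)) := by gcongr
        _ = 3 * n / (n : ℝ) ^ 4 * (1 / (n : ℝ) ^ β) := by
            rw [h2]
            field_simp
        _ ≤ 1 / 2 * (1 / (n : ℝ) ^ β) := by
            refine mul_le_mul_of_nonneg_right ?_ (by positivity)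
            rw [div_le_iff₀ (by positivity)]
            linarith
  have hε' : (23 / 24 : ℝ) ^ M ≤ 1 / 2 * (1 / (n : ℝ) ^ β) := by
    calc (23 / 24 : ℝ) ^ M ≤ Real.exp (-(1 / 24)) ^ M := by
          refine pow_le_pow_left₀ (by norm_num) ?_ _
          linarith [Real.add_one_le_exp (-(1 / 24) : ℝ)]
      _ = Real.exp (-(M / 24)) := by
          rw [← Real.exp_nat_mul]
          congr 1
          ring
      _ ≤ Real.exp (-((β + 1) * Real.log n)) := by
          refine Real.exp_le_exp.2 (neg_le_neg ?_)
          have : 24 * (β + 1) * Real.log n ≤ M := by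
            rw [hM]
            exact Nat.le_ceil _
          linarith
      _ = 1 / (n : ℝ) * (1 / (n : ℝ) ^ β) := by
          rw [hexp, Real.rpow_add hn0, Real.rpow_one]
          field_simp
      _ ≤ _ := by
          refine mul_le_mul_of_nonneg_right ?_ (by positivity)
          exact one_div_le_one_div_of_le (by norm_num) hnR
  have hbal := card_not_balanced_le (N := N) (D := D) hδ hn1 hf hb1 hb2 hDlt (by positivity) hε
  have := card_not_good_le (G := G) (k := k) (M := M) hbal (by omega) hDb hε'
  rw [← add_mul, add_halves, one_mul] at this
  convert this

/-- The bounds on the numbers of rounds and messages, with explicit constants. -/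
lemma rounds_and_messages_le {c c' : ℝ} (hc : 0 ≤ c) (hc' : 0 ≤ c') {n : ℕ} (hn : 2 ≤ n) {C : ℝ}
    (hC : C = 12 + 5 * (24 * c' + 2) * (4 * (c + 4))) :
    ((2 + 5 * phaseNumber c' n * slotNumber c n + 1 : ℕ) : ℝ) ≤ 16 * C * Real.log n ^ 6 ∧
    (((2 + 5 * phaseNumber c' n * slotNumber c n + 1) * (2 * (n * slotNumber c n)) : ℕ) : ℝ) ≤
      8 * C * (c + 4) * n * Real.log n ^ 3 := by
  have hnR : (2 : ℝ) ≤ n := by exact_mod_cast hn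
  set l := Real.log n with hl
  have hl1 : 1 ≤ 2 * l := by
    have := Real.log_le_log (by norm_num) hnR
    linarith [Real.log_two_gt_d9]
  have hl0 : 0 < l := by linarith
  have hsq : 1 ≤ 4 * l ^ 2 := by nlinarith
  have hM : (phaseNumber c' n : ℝ) ≤ (24 * c' + 2) * l := by
    have := Nat.ceil_lt_add_one (a := 24 * c' * Real.log n) (by positivity)
    rw [phaseNumber]
    linarith
  have hD : (slotNumber c n : ℝ) ≤ 4 * (c + 4) * l := by
    have h1 : (slotNumber c n : ℝ) ≤ 4 * bucketSize c n := by exact_mod_cast slotNumber_le c n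
    have h2 := Nat.ceil_lt_add_one (a := c * Real.log n) (by positivity)
    rw [bucketSize] at h1
    push_cast at h1
    linarith
  have hT : ((2 + 5 * phaseNumber c' n * slotNumber c n + 1 : ℕ) : ℝ) ≤ C * l ^ 2 := by
    have : (phaseNumber c' n : ℝ) * slotNumber c n ≤ (24 * c' + 2) * l * (4 * (c + 4) * l) := by
      gcongr
    push_cast
    rw [hC]
    linarith
  have hC0 : 0 ≤ C := by
    rw [hC]
    positivity
  constructor
  · refine hT.trans ?_
    have h4 : 1 ≤ 16 * l ^ 4 := by nlinarith
    have := mul_le_mul_of_nonneg_left h4 (by positivity : 0 ≤ C * l ^ 2)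
    calc C * l ^ 2 ≤ C * l ^ 2 * (16 * l ^ 4) := by linarith
      _ = _ := by ring
  · rw [Nat.cast_mul]
    calc _ ≤ C * l ^ 2 * (2 * (n * (4 * (c + 4) * l))) := by
          push_cast at hT ⊢
          gcongr
      _ = _ := by ring

end ByzRenaming

open ByzRenaming in
theorem theorem1 (δ : ℝ) (hδ : 0 < δ) (β : ℝ) (hβ : 1 ≤ β) :
    ∃ (P : (n N : ℕ) → ByzRenaming.Protocol n) (K : ℕ),
      ∀ n N : ℕ, 1 ≤ n → n ≤ N →
        (P n N).MessagesAtMost N (K * Nat.size N) ∧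
        ∀ G : ByzRenaming.Network n N, (G.byz.card : ℝ) < (1 / 3 - δ) * (n : ℝ) →
          ∀ A : (P n N).Coins → ByzRenaming.Behaviour n,
            (∀ ω, ByzRenaming.Authentic (P n N) G ω (A ω)) →
            1 - 1 / (n : ℝ) ^ β ≤
              (P n N).prob {ω | ByzRenaming.Succeeds (P n N) G ω (A ω)
                ((K : ℝ) * Real.log n ^ 6) ((K : ℝ) * (n : ℝ) * Real.log n ^ 3)} := by
  classical
  set c : ℝ := (β + 4) / (δ / 2) ^ 2 with hc
  have hc0 : 0 ≤ c := by positivity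
  have hcδ : β + 4 ≤ (δ / 2) ^ 2 * c := by
    rw [hc]
    field_simp
    exact le_rfl
  set C : ℝ := 12 + 5 * (24 * (β + 1) + 2) * (4 * (c + 4)) with hC
  have hC0 : 0 ≤ C := by positivity
  refine ⟨fun n N => Plan.protocol (fun s : Seed N (bucketsPred c n) (2 * slotNumber c n - 1)
    (phaseNumber (β + 1) n) => randomPlan (slotNumber c n) (byzBound c n) s) n N,
    ⌈16 * C⌉₊ + ⌈8 * C * (c + 4)⌉₊ + 2, fun n N hn hnN => ⟨?_, ?_⟩⟩
  · exact Plan.protocol_messagesAtMost _ (hn.trans hnN) (by omega)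
  intro G hf A _
  -- For `n = 1` the claimed probability is `0`.
  rcases hn.eq_or_lt with rfl | hn2
  · rw [Nat.cast_one, Real.one_rpow, div_one, sub_self]
    exact div_nonneg (Nat.cast_nonneg _) (Nat.cast_nonneg _)
  have hcost := rounds_and_messages_le hc0 (by positivity : 0 ≤ β + 1) hn2 hC
  have hlog : 0 ≤ Real.log n := Real.log_natCast_nonneg n
  refine Plan.le_prob _ (Q := fun s => (randomPlan _ _ s).Good G) (fun ω hω => ?_)
    (card_not_good_le_rpow hδ hn2 hf hcδ rfl rfl rfl rfl rfl)
  refine Plan.succeeds _ G ω (A ω) hω (hcost.1.trans ?_) (hcost.2.trans ?_)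
  · gcongr
    push_cast
    linarith [Nat.le_ceil (16 * C), Nat.cast_nonneg (α := ℝ) ⌈8 * C * (c + 4)⌉₊]
  · gcongr
    push_cast
    linarith [Nat.le_ceil (8 * C * (c + 4)), Nat.cast_nonneg (α := ℝ) ⌈16 * C⌉₊]
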